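/- Let $N\ge 3$ buyers have independent private values $X_1,\dots,X_N\ge 0$ for an indivisible good, each with distribution $F$ with support $[\underline x,\bar x]$, $\underline x\ge 0$, and a density $f$ that is continuous on $[\underline x,\bar x]$. Suppose that the virtual valuation $\psi(x)=x-\frac{1-F(x)}{f(x)}$ is (weakly) increasing on $[\underline x,\bar x]$ (with $c/0=\infty$ for $c>0$ and $0/0=0$). Each buyer wants one unit. Two sellers sell one identical unit each, one after the other; the second one uses a second-price auction without a (binding) reserve price, in which all buyers who did not obtain the first unit bid their values, so that a buyer $i$ without the first unit gets the continuation payoff $\max\{x_i-\max_j x_j,0\}$, where $j$ ranges over the other buyers who did not obtain the first unit. For a vector $b$ write $b_{(k)}$ for its $k$-th highest entry, and for $x\in[\underline x,\bar x]$ let $a(x)=\min\{a\in[\underline x,\bar x]: a\ge x,\ a+\psi(a)\ge x\}$. The modified third-price auction of the first unit is the following: each buyer submits a bid in $[\underline x,\bar x]$. If $b_{(2)}\ge a(b_{(3)})$, the unit is allocated to the second-highest bidder; otherwise it is not allocated and no one pays. If it is allocated, then: when $\psi(b_{(3)})\ge 0$, the second-highest bidder pays $b_{(3)}$ and the others pay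 nothing; when $\psi(b_{(3)})<0$, the highest bidder pays $a(b_{(3)})-b_{(3)}$, the second-highest bidder pays $a(b_{(3)})$, and the others pay nothing. Ties are broken by a priority order on the buyers that is drawn from any fixed distribution independent of the values and bids (for example uniformly). A direct mechanism for the first seller consists of measurable allocation probabilities $P_i(x)\ge0$ with $\sum_i P_i(x)\le 1$ and measurable transfers $t_i(x)$ from the buyers, as functions of the reports $x\in[\underline x,\bar x]^N$, with well-defined ex ante and interim expected transfers. It is feasible if truthful reporting is a Bayesian Nash equilibrium (incentive compatibility) and every type of every buyer gets at least the expected payoff that he would get in the second auction if the first unit were allocated to no one (individual rationality). Then: 1. Truthful bidding is an ex post equilibrium of the modified third-price auction: for every profile of values, no buyer can raise his payoff over both periods (expected over the tie-breaking) by another bid in $[\underline x,\bar x]$. It is also a Bayesian Nash equilibrium. 2. In this equilibrium the expected revenue of the first seller is $E\max\{\psi(X_{(2)})+X_{(2)}-X_{(3)},0\}$, and this expectation is finite. 3. This is the optimal expected revenue: the modified third-price auction with truthful bidding is a feasible direct mechanism, and no feasible direct mechanism has a higher expected revenue. -/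

import Mathlib

open MeasureTheory ProbabilityTheory Set

noncomputable section

namespace SequentialAuction

/-- `μ` is a distribution of buyer values with support `[lo, hi]`, `lo ≥ 0`, and density `f`
(with respect to Lebesgue measure) that is continuous on `[lo, hi]`. -/
structure IsValueDistribution (μ : Measure ℝ) (f : ℝ → ℝ) (lo hi : ℝ) : Prop where
  isProbabilityMeasure : IsProbabilityMeasure μ
  lo_nonneg : 0 ≤ lo
  support_eq : μ.support = Icc lo hi
  density_nonneg : ∀ x, 0 ≤ f x
  density_eq_zero : ∀ x, x ∉ Icc lo hi → f x = 0
  density_continuousOn : ContinuousOn f (Icc lo hi)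
  eq_withDensity : μ = volume.withDensity (fun x => ENNReal.ofReal (f x))

/-- The virtual valuation `ψ x = x - (1 - F x) / f x`. The quotient is taken in `[0, ∞]`, where
`c / 0 = ∞` for `c ≠ 0` and `0 / 0 = 0`, so that `ψ x = -∞` where the density vanishes and
`F x < 1`, and `ψ x = x` where `F x = 1`. -/
def virtualValue (μ : Measure ℝ) (f : ℝ → ℝ) (x : ℝ) : EReal :=
  (x : EReal) - ((ENNReal.ofReal (1 - cdf μ x) / ENNReal.ofReal (f x) : ENNReal) : EReal)

/-- The threshold `a x = min {a ≥ x : a + ψ a ≥ x}`, where `a` ranges over `[lo, hi]`. -/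
def threshold (ψ : ℝ → EReal) (lo hi x : ℝ) : ℝ :=
  sInf {a : ℝ | a ∈ Icc lo hi ∧ x ≤ a ∧ (x : EReal) ≤ (a : EReal) + ψ a}

/-- The `k`-th highest of the numbers `b 0, …, b (N - 1)` (for `1 ≤ k ≤ N`): the largest `c` such
that at least `k` of them are at least `c`. -/
def kthHighest {N : ℕ} (b : Fin N → ℝ) (k : ℕ) : ℝ :=
  sSup {c : ℝ | k ≤ (Finset.univ.filter fun j => c ≤ b j).card}

/-- Bidder `j` is ranked above bidder `i`: a higher bid, or an equal bid and an earlier place in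
the priority order `σ`. -/
def RankedAbove {N : ℕ} (σ : Equiv.Perm (Fin N)) (b : Fin N → ℝ) (j i : Fin N) : Prop :=
  b i < b j ∨ (b i = b j ∧ σ j < σ i)

open Classical in
/-- The position of bidder `i` in the ranking: `1` for the highest bidder, `2` for the
second-highest bidder, and so on. -/
def position {N : ℕ} (σ : Equiv.Perm (Fin N)) (b : Fin N → ℝ) (i : Fin N) : ℕ :=
  (Finset.univ.filter fun j => RankedAbove σ b j i).card + 1

/-- A mechanism for the first unit, in which every buyer submits a number: the probability
`alloc b i` that buyer `i` receives the unit and the expected payment `pay b i` of buyer `i` to the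
first seller, as functions of the vector `b` of submitted numbers. -/
structure Mechanism (N : ℕ) where
  alloc : (Fin N → ℝ) → Fin N → ℝ
  pay : (Fin N → ℝ) → Fin N → ℝ

/-- The second-period payoff of buyer `i`, who did not get the first unit, when `w` says who got
the first unit (`none` if it was withheld): the second unit is sold in a second-price auction with
reserve price zero, in which all buyers without a unit bid their true values `x`. -/
def secondPeriodPayoff {N : ℕ} (x : Fin N → ℝ) (i : Fin N) (w : Option (Fin N)) : ℝ :=
  max (x i - ⨆ j : {j : Fin N // j ≠ i ∧ w ≠ some j}, x j) 0

/-- The expected payoff of buyer `i` over both periods, before payments to the first seller, when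
the true values are `x` and buyer `j` gets the first unit with probability `p j`. -/
def grossPayoff {N : ℕ} (p : Fin N → ℝ) (x : Fin N → ℝ) (i : Fin N) : ℝ :=
  p i * x i + ∑ j ∈ Finset.univ.erase i, p j * secondPeriodPayoff x i (some j)
    + (1 - ∑ j, p j) * secondPeriodPayoff x i none

/-- The expected net payoff of buyer `i` when the numbers `b` are submitted and the true values
are `x`. -/
def payoff {N : ℕ} (M : Mechanism N) (b x : Fin N → ℝ) (i : Fin N) : ℝ :=
  grossPayoff (M.alloc b) x i - M.pay b i

/-- The strategy profile `β` (buyer `j` with value `v` submits `β j v`) is an ex post equilibrium: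
at every profile of values, no buyer gains by submitting another number in `[lo, hi]`. -/
def IsExPostEquilibrium {N : ℕ} (lo hi : ℝ) (M : Mechanism N) (β : Fin N → ℝ → ℝ) : Prop :=
  ∀ x : Fin N → ℝ, (∀ j, x j ∈ Icc lo hi) → ∀ i, ∀ q ∈ Icc lo hi,
    payoff M (Function.update (fun j => β j (x j)) i q) x i ≤ payoff M (fun j => β j (x j)) x i

/-- The interim expected payoff of buyer `i` with value `v` who submits `q` when the rivals, whose
values are independent with law `μ`, follow `β`. (The `i`-th coordinate of the sampled vector is
overwritten.) -/
def interimPayoff {N : ℕ} (μ : Measure ℝ) (M : Mechanism N) (β : Fin N → ℝ → ℝ)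
    (i : Fin N) (v q : ℝ) : ℝ :=
  ∫ x, payoff M (Function.update (fun j => β j (x j)) i q) (Function.update x i v) i
    ∂(Measure.pi fun _ : Fin N => μ)

/-- The strategy profile `β` is a Bayesian Nash equilibrium. -/
def IsBayesNashEquilibrium {N : ℕ} (μ : Measure ℝ) (lo hi : ℝ) (M : Mechanism N)
    (β : Fin N → ℝ → ℝ) : Prop :=
  ∀ i, ∀ v ∈ Icc lo hi, ∀ q ∈ Icc lo hi,
    interimPayoff μ M β i v q ≤ interimPayoff μ M β i v (β i v)

/-- Every buyer submits his true value. -/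
def truthful (N : ℕ) : Fin N → ℝ → ℝ := fun _ v => v

/-- `M` is a direct mechanism on reports in `[lo, hi]`, with well-defined expected transfers. -/
structure IsDirectMechanism {N : ℕ} (μ : Measure ℝ) (lo hi : ℝ) (M : Mechanism N) : Prop where
  measurable_alloc : ∀ i, Measurable fun b => M.alloc b i
  measurable_pay : ∀ i, Measurable fun b => M.pay b i
  alloc_nonneg : ∀ b, (∀ j, b j ∈ Icc lo hi) → ∀ i, 0 ≤ M.alloc b i
  sum_alloc_le_one : ∀ b, (∀ j, b j ∈ Icc lo hi) → ∑ i, M.alloc b i ≤ 1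
  integrable_pay : ∀ i, Integrable (fun x => M.pay x i) (Measure.pi fun _ : Fin N => μ)
  integrable_interim_pay : ∀ i, ∀ q ∈ Icc lo hi,
    Integrable (fun x => M.pay (Function.update x i q) i) (Measure.pi fun _ : Fin N => μ)

/-- Individual rationality: each type of each buyer gets at least the expected payoff from the
second auction when the first unit is allocated to no one. -/
def IsIndividuallyRational {N : ℕ} (μ : Measure ℝ) (lo hi : ℝ) (M : Mechanism N) : Prop :=
  ∀ i, ∀ v ∈ Icc lo hi,
    ∫ x, secondPeriodPayoff (Function.update x i v) i none ∂(Measure.pi fun _ : Fin N => μ)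
      ≤ interimPayoff μ M (truthful N) i v v

/-- The mechanisms among which the first seller chooses: incentive compatible and individually
rational direct mechanisms. -/
structure IsFeasible {N : ℕ} (μ : Measure ℝ) (lo hi : ℝ) (M : Mechanism N) : Prop where
  isDirectMechanism : IsDirectMechanism μ lo hi M
  incentiveCompatible : IsBayesNashEquilibrium μ lo hi M (truthful N)
  individuallyRational : IsIndividuallyRational μ lo hi M

/-- The expected revenue of the first seller when all buyers submit their values. -/
def expectedRevenue {N : ℕ} (μ : Measure ℝ) (M : Mechanism N) : ℝ :=
  ∫ x, ∑ i, M.pay x i ∂(Measure.pi fun _ : Fin N => μ)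

/-- In the modified third-price auction the first unit is allocated at bids `b` if and only if
the second-highest bid is at least the threshold of the third-highest bid. -/
def IsAllocated {N : ℕ} (ψ : ℝ → EReal) (lo hi : ℝ) (b : Fin N → ℝ) : Prop :=
  threshold ψ lo hi (kthHighest b 3) ≤ kthHighest b 2

open Classical in
/-- Allocation in the modified third-price auction, ties being broken by the priority order `σ`:
the unit goes to the second-highest bidder if it is allocated. -/
def thirdPriceAlloc {N : ℕ} (ψ : ℝ → EReal) (lo hi : ℝ) (σ : Equiv.Perm (Fin N))
    (b : Fin N → ℝ) (i : Fin N) : ℝ :=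
  if IsAllocated ψ lo hi b ∧ position σ b i = 2 then 1 else 0

open Classical in
/-- Payments in the modified third-price auction, ties being broken by the priority order `σ`. -/
def thirdPricePay {N : ℕ} (ψ : ℝ → EReal) (lo hi : ℝ) (σ : Equiv.Perm (Fin N))
    (b : Fin N → ℝ) (i : Fin N) : ℝ :=
  if IsAllocated ψ lo hi b then
    if position σ b i = 1 then
      (if ψ (kthHighest b 3) < 0 then threshold ψ lo hi (kthHighest b 3) - kthHighest b 3 else 0)
    else if position σ b i = 2 then
      (if ψ (kthHighest b 3) < 0 then threshold ψ lo hi (kthHighest b 3) else kthHighest b 3)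
    else 0
  else 0

/-- The modified third-price auction, where the priority order that breaks ties is drawn with
probabilities `τ` (uniform `τ`: ties are broken uniformly at random). -/
def modifiedThirdPriceAuction {N : ℕ} (ψ : ℝ → EReal) (lo hi : ℝ)
    (τ : Equiv.Perm (Fin N) → ℝ) : Mechanism N where
  alloc b i := ∑ σ, τ σ * thirdPriceAlloc ψ lo hi σ b i
  pay b i := ∑ σ, τ σ * thirdPricePay ψ lo hi σ b i

/-- The integrand `max {ψ x₍₂₎ + x₍₂₎ - x₍₃₎, 0}` of the optimal expected revenue. -/
def optimalRevenueAt {N : ℕ} (ψ : ℝ → EReal) (x : Fin N → ℝ) : ℝ :=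
  (max (ψ (kthHighest x 2) + ((kthHighest x 2 - kthHighest x 3 : ℝ) : EReal)) 0).toReal

end SequentialAuction

end

/-!
Every type of every buyer faces a linear problem in his own value, so incentive compatibility makes
his interim payoff convex in that value, with the interim probability of ending up with a unit as a
subgradient. As in Myerson's analysis, the revenue is therefore the expected virtual surplus over
both periods minus the payoffs of the lowest types. The mechanism that always withholds the first
unit has revenue zero, so only the increase of the virtual surplus over withholding matters. At
values `x₁ > x₂ > x₃ ≥ …` the increase is `ψ x₂ + x₂ - x₃` if the unit goes to one of the two
highest buyers and `ψ xₗ` if it goes to buyer `l` otherwise; as `ψ` is increasing, its maximum is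
`max (ψ x₂ + x₂ - x₃) 0`, and the modified third-price auction attains it. Truthful
bidding is an ex post equilibrium because a buyer whose two highest rival values are `y ≥ z` gets
`max (xᵢ - min (a z) y) 0` by bidding his value, and no more than that by any other bid.
-/

noncomputable section

namespace SequentialAuction

open scoped Matrix

/-! ### Ranking of the bidders -/

section Ranking

variable {N : ℕ} {σ : Equiv.Perm (Fin N)} {b : Fin N → ℝ} {i j k l : Fin N}

/-- The key in a linear order by which bidders are ranked: the bid first, then the place in the
priority order, where an earlier place is better. -/
def rankKey (σ : Equiv.Perm (Fin N)) (b : Fin N → ℝ) (i : Fin N) : Lex (ℝ × (Fin N)ᵒᵈ) :=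
  toLex (b i, OrderDual.toDual (σ i))

lemma rankedAbove_iff_rankKey_lt : RankedAbove σ b j i ↔ rankKey σ b i < rankKey σ b j := by
  simp [RankedAbove, rankKey, Prod.Lex.toLex_lt_toLex]

lemma rankKey_injective : Function.Injective (rankKey σ b) := fun _ _ h =>
  σ.injective (OrderDual.toDual.injective (congrArg (fun p => (ofLex p).2) h))

lemma RankedAbove.trans (hij : RankedAbove σ b i j) (hjk : RankedAbove σ b j k) :
    RankedAbove σ b i k := by
  rw [rankedAbove_iff_rankKey_lt] at *
  exact hjk.trans hij

lemma RankedAbove.asymm (h : RankedAbove σ b i j) : ¬ RankedAbove σ b j i := by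
  rw [rankedAbove_iff_rankKey_lt] at *
  exact h.not_gt

lemma not_rankedAbove_self : ¬ RankedAbove σ b i i := fun h => h.asymm h

lemma RankedAbove.ne (h : RankedAbove σ b i j) : i ≠ j := by
  rintro rfl
  exact not_rankedAbove_self h

lemma RankedAbove.le (h : RankedAbove σ b i j) : b j ≤ b i := h.elim le_of_lt fun h => h.1.le

lemma rankedAbove_or_rankedAbove (h : i ≠ j) : RankedAbove σ b i j ∨ RankedAbove σ b j i := by
  simp only [rankedAbove_iff_rankKey_lt]
  exact (rankKey_injective.ne h).lt_or_gt.symm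

lemma rankedAbove_iff_lt (hb : Function.Injective b) : RankedAbove σ b i j ↔ b j < b i :=
  ⟨fun h => h.le.lt_of_ne (hb.ne h.ne.symm), Or.inl⟩

lemma rankedAbove_update_iff {q : ℝ} (hi : i ≠ l) (hj : j ≠ l) :
    RankedAbove σ (Function.update b l q) i j ↔ RankedAbove σ b i j := by
  simp only [RankedAbove, Function.update_of_ne hi, Function.update_of_ne hj]

lemma position_lt_position (h : RankedAbove σ b i j) : position σ b i < position σ b j := by
  classical
  refine Nat.succ_lt_succ (Finset.card_lt_card (Finset.ssubset_iff_of_subset ?_ |>.2 ⟨i, ?_, ?_⟩))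
  · exact Finset.monotone_filter_right _ fun l _ hl => hl.trans h
  · simpa using h
  · simpa using not_rankedAbove_self

lemma position_lt_position_iff : position σ b i < position σ b j ↔ RankedAbove σ b i j := by
  refine ⟨fun h => ?_, position_lt_position⟩
  have hij : i ≠ j := by
    rintro rfl
    exact h.false
  exact (rankedAbove_or_rankedAbove hij).resolve_right fun hji =>
    h.asymm (position_lt_position hji)

lemma position_injective : Function.Injective (position σ b) := by
  intro i j h
  by_contra hij
  rcases rankedAbove_or_rankedAbove hij with hij | hji
  · exact (position_lt_position hij).ne h
  · exact (position_lt_position hji).ne h.symm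

lemma position_eq_card_add_one {s : Finset (Fin N)} (h : ∀ l, RankedAbove σ b l i ↔ l ∈ s) :
    position σ b i = s.card + 1 := by
  simp only [position, h, Finset.filter_univ_mem]

lemma position_eq_two (hij : RankedAbove σ b i j)
    (h : ∀ l, l ≠ i → l ≠ j → RankedAbove σ b j l) : position σ b j = 2 := by
  have hs : ∀ l, RankedAbove σ b l j ↔ l ∈ ({i} : Finset (Fin N)) := by
    refine fun l => ⟨fun hl => ?_, fun hl => Finset.mem_singleton.1 hl ▸ hij⟩
    by_contra hli
    exact hl.asymm (h l (by simpa using hli) hl.ne)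
  rw [position_eq_card_add_one hs, Finset.card_singleton]

lemma one_le_position : 1 ≤ position σ b i := Nat.le_add_left 1 _

lemma position_le : position σ b i ≤ N := by
  classical
  have h : (Finset.univ.filter fun j => RankedAbove σ b j i) ⊂ Finset.univ :=
    Finset.filter_ssubset.2 ⟨i, Finset.mem_univ i, not_rankedAbove_self⟩
  exact (Finset.card_lt_card h).trans_eq (by simp)

lemma exists_position_eq (σ : Equiv.Perm (Fin N)) (b : Fin N → ℝ) {n : ℕ} (hn : n ∈ Icc 1 N) :
    ∃ i, position σ b i = n := by
  have hsurj := Finset.surjOn_of_injOn_of_card_le (s := Finset.univ) (t := Finset.Icc 1 N)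
    (position σ b) (fun i _ => by simpa using ⟨one_le_position, position_le⟩)
    position_injective.injOn (by simp)
  obtain ⟨i, -, hi⟩ := hsurj (by simpa using hn)
  exact ⟨i, hi⟩

lemma position_le_card_filter_iff {c : ℝ} :
    position σ b i ≤ (Finset.univ.filter fun j => c ≤ b j).card ↔ c ≤ b i := by
  classical
  refine ⟨fun h => ?_, fun h => ?_⟩
  · contrapose! h
    exact Nat.lt_succ_of_le
      (Finset.card_le_card (Finset.monotone_filter_right _ fun j _ hj => Or.inl (h.trans_le hj)))
  · have hi : i ∉ Finset.univ.filter fun j => RankedAbove σ b j i := by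
      simpa using not_rankedAbove_self
    rw [position, ← Finset.card_insert_of_notMem hi]
    refine Finset.card_le_card (Finset.insert_subset (by simpa using h) ?_)
    exact Finset.monotone_filter_right _ fun j _ hj => h.trans hj.le

lemma kthHighest_position : kthHighest b (position σ b i) = b i := by
  simp only [kthHighest, position_le_card_filter_iff]
  exact csSup_Iic

lemma le_kthHighest_iff {n : ℕ} (hn : n ∈ Icc 1 N) {c : ℝ} :
    c ≤ kthHighest b n ↔ n ≤ (Finset.univ.filter fun j => c ≤ b j).card := by
  obtain ⟨i, rfl⟩ := exists_position_eq 1 b hn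
  rw [kthHighest_position, position_le_card_filter_iff]

/-- Bidders `i`, `j` and `k` are, in this order, the three highest-ranked bidders. -/
structure AreTopThree (σ : Equiv.Perm (Fin N)) (b : Fin N → ℝ) (i j k : Fin N) : Prop where
  first : RankedAbove σ b i j
  second : RankedAbove σ b j k
  rest : ∀ l, l ≠ i → l ≠ j → l ≠ k → RankedAbove σ b k l

/-- Among the rivals of buyer `i`, buyer `j` is ranked first and buyer `k` second. -/
structure AreTopRivals (σ : Equiv.Perm (Fin N)) (b : Fin N → ℝ) (i j k : Fin N) : Prop where
  fst_ne : j ≠ i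
  snd_ne : k ≠ i
  first : RankedAbove σ b j k
  rest : ∀ l, l ≠ i → l ≠ j → l ≠ k → RankedAbove σ b k l

lemma exists_areTopThree (hN : 3 ≤ N) (σ : Equiv.Perm (Fin N)) (b : Fin N → ℝ) :
    ∃ i j k, AreTopThree σ b i j k := by
  obtain ⟨i, hi⟩ := exists_position_eq σ b (n := 1) ⟨le_rfl, by lia⟩
  obtain ⟨j, hj⟩ := exists_position_eq σ b (n := 2) ⟨by lia, by lia⟩
  obtain ⟨k, hk⟩ := exists_position_eq σ b (n := 3) ⟨by lia, hN⟩
  refine ⟨i, j, k, position_lt_position_iff.1 (by lia), position_lt_position_iff.1 (by lia),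
    fun l hli hlj hlk => position_lt_position_iff.1 ?_⟩
  have := position_injective (σ := σ) (b := b) |>.ne hli
  have := position_injective (σ := σ) (b := b) |>.ne hlj
  have := position_injective (σ := σ) (b := b) |>.ne hlk
  have := one_le_position (σ := σ) (b := b) (i := l)
  lia

lemma exists_areTopRivals (hN : 3 ≤ N) (σ : Equiv.Perm (Fin N)) (b : Fin N → ℝ) (i : Fin N) :
    ∃ j k, AreTopRivals σ b i j k := by
  obtain ⟨p, q, r, h⟩ := exists_areTopThree hN σ b
  by_cases hp : i = p
  · subst hp
    exact ⟨q, r, h.first.ne.symm, (h.first.trans h.second).ne.symm, h.second, h.rest⟩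
  by_cases hq : i = q
  · subst hq
    exact ⟨p, r, h.first.ne, h.second.ne.symm, h.first.trans h.second,
      fun l hi hp hr => h.rest l hp hi hr⟩
  refine ⟨p, q, Ne.symm hp, Ne.symm hq, h.first, fun l _ hp hq => ?_⟩
  by_cases hr : l = r
  · exact hr ▸ h.second
  · exact h.second.trans (h.rest l hp hq hr)

lemma AreTopThree.second_rankedAbove (h : AreTopThree σ b i j k) (hli : l ≠ i) (hlj : l ≠ j) :
    RankedAbove σ b j l := by
  by_cases hlk : l = k
  · exact hlk ▸ h.second
  · exact h.second.trans (h.rest l hli hlj hlk)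

lemma AreTopThree.first_rankedAbove (h : AreTopThree σ b i j k) (hli : l ≠ i) :
    RankedAbove σ b i l := by
  by_cases hlj : l = j
  · exact hlj ▸ h.first
  · exact h.first.trans (h.second_rankedAbove hli hlj)

lemma AreTopThree.position_first (h : AreTopThree σ b i j k) : position σ b i = 1 := by
  have hs : ∀ l, RankedAbove σ b l i ↔ l ∈ (∅ : Finset (Fin N)) := by
    refine fun l => iff_of_false (fun hl => ?_) (Finset.notMem_empty l)
    exact hl.asymm (h.first_rankedAbove hl.ne)
  rw [position_eq_card_add_one hs, Finset.card_empty]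

lemma AreTopThree.position_second (h : AreTopThree σ b i j k) : position σ b j = 2 :=
  position_eq_two h.first fun _ => h.second_rankedAbove

lemma AreTopThree.position_third (h : AreTopThree σ b i j k) : position σ b k = 3 := by
  have hs : ∀ l, RankedAbove σ b l k ↔ l ∈ ({i, j} : Finset (Fin N)) := by
    simp only [Finset.mem_insert, Finset.mem_singleton]
    refine fun l => ⟨fun hl => ?_, ?_⟩
    · by_contra! hne
      exact hl.asymm (h.rest l hne.1 hne.2 hl.ne)
    · rintro (rfl | rfl)
      exacts [h.first.trans h.second, h.second]
  rw [position_eq_card_add_one hs, Finset.card_pair h.first.ne]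

lemma AreTopThree.kthHighest_two (h : AreTopThree σ b i j k) : kthHighest b 2 = b j :=
  h.position_second ▸ kthHighest_position

lemma AreTopThree.kthHighest_three (h : AreTopThree σ b i j k) : kthHighest b 3 = b k :=
  h.position_third ▸ kthHighest_position

lemma AreTopRivals.first_rankedAbove (h : AreTopRivals σ b i j k) (hli : l ≠ i) (hlj : l ≠ j) :
    RankedAbove σ b j l := by
  by_cases hlk : l = k
  · exact hlk ▸ h.first
  · exact h.first.trans (h.rest l hli hlj hlk)

lemma AreTopRivals.update (h : AreTopRivals σ b i j k) (q : ℝ) :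
    AreTopRivals σ (Function.update b i q) i j k where
  fst_ne := h.fst_ne
  snd_ne := h.snd_ne
  first := (rankedAbove_update_iff h.fst_ne h.snd_ne).2 h.first
  rest l hi hj hk := (rankedAbove_update_iff h.snd_ne hi).2 (h.rest l hi hj hk)

end Ranking

/-! ### The second auction -/

section SecondPeriod

variable {N : ℕ} {x : Fin N → ℝ} {i j k : Fin N} {w : Option (Fin N)}

/-- The highest value among the rivals of buyer `i` in the second auction, when `w` says who
got the first unit. By the convention for `⨆`, it is `0` if there is no rival. -/
def rivalMax (x : Fin N → ℝ) (i : Fin N) (w : Option (Fin N)) : ℝ :=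
  ⨆ j : {j : Fin N // j ≠ i ∧ w ≠ some j}, x j

lemma secondPeriodPayoff_eq : secondPeriodPayoff x i w = max (x i - rivalMax x i w) 0 := rfl

lemma rivalMax_eq (hj : j ≠ i) (hw : w ≠ some j) (h : ∀ l, l ≠ i → w ≠ some l → x l ≤ x j) :
    rivalMax x i w = x j := by
  refine IsGreatest.csSup_eq ⟨⟨⟨j, hj, hw⟩, rfl⟩, ?_⟩
  rintro _ ⟨l, rfl⟩
  exact h l l.2.1 l.2.2

lemma rivalMax_update (v : ℝ) : rivalMax (Function.update x i v) i w = rivalMax x i w :=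
  iSup_congr fun j => Function.update_of_ne j.2.1 v x

lemma le_rivalMax (hj : j ≠ i) (hw : w ≠ some j) : x j ≤ rivalMax x i w :=
  le_ciSup (f := fun j : {j : Fin N // j ≠ i ∧ w ≠ some j} => x j)
    (Set.finite_range _).bddAbove ⟨j, hj, hw⟩

lemma secondPeriodPayoff_nonneg : 0 ≤ secondPeriodPayoff x i w := le_max_right _ _

lemma secondPeriodPayoff_le (hx : ∀ j, 0 ≤ x j) : secondPeriodPayoff x i w ≤ x i :=
  max_le (sub_le_self _ (Real.iSup_nonneg fun j => hx j)) (hx i)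

lemma secondPeriodPayoff_eq_zero (hj : j ≠ i) (hw : w ≠ some j) (h : x i ≤ x j) :
    secondPeriodPayoff x i w = 0 :=
  max_eq_right (sub_nonpos.2 (h.trans (le_rivalMax hj hw)))

variable {σ : Equiv.Perm (Fin N)}

lemma AreTopRivals.secondPeriodPayoff_eq (h : AreTopRivals σ x i j k) (hw : w ≠ some j) :
    secondPeriodPayoff x i w = max (x i - x j) 0 := by
  rw [SequentialAuction.secondPeriodPayoff_eq, rivalMax_eq h.fst_ne hw]
  intro l hli _
  by_cases hlj : l = j
  · rw [hlj]
  · exact (h.first_rankedAbove hli hlj).le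

lemma AreTopRivals.secondPeriodPayoff_some_first (h : AreTopRivals σ x i j k) :
    secondPeriodPayoff x i (some j) = max (x i - x k) 0 := by
  rw [SequentialAuction.secondPeriodPayoff_eq, rivalMax_eq h.snd_ne (by simpa using h.first.ne)]
  intro l hli hlj
  by_cases hlk : l = k
  · rw [hlk]
  · exact (h.rest l hli (fun e => hlj (congrArg some e.symm)) hlk).le

end SecondPeriod

/-! ### Random outcomes of the first auction -/

section Outcome

lemma dotProduct_mem_of_mem_stdSimplex {ι : Type*} [Fintype ι] {p V : ι → ℝ} {s : Set ℝ}
    (hs : Convex ℝ s) (hp : p ∈ stdSimplex ℝ ι) (hV : ∀ w, V w ∈ s) : p ⬝ᵥ V ∈ s :=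
  hs.sum_mem (fun w _ => hp.1 w) hp.2 fun w _ => hV w

/-- The law of the outcome of the first auction (`some j` if buyer `j` gets the unit, `none` if it
is withheld) when buyer `j` gets the unit with probability `p j`. -/
def outcomeLaw {ι : Type*} [Fintype ι] (p : ι → ℝ) (w : Option ι) : ℝ :=
  w.elim (1 - ∑ j, p j) p

lemma outcomeLaw_dotProduct {ι : Type*} [Fintype ι] (p : ι → ℝ) (V : Option ι → ℝ) :
    outcomeLaw p ⬝ᵥ V = (1 - ∑ j, p j) * V none + ∑ j, p j * V (some j) :=
  Fintype.sum_option _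

lemma outcomeLaw_mem_stdSimplex {ι : Type*} [Fintype ι] {p : ι → ℝ} (hp : ∀ j, 0 ≤ p j)
    (hp1 : ∑ j, p j ≤ 1) : outcomeLaw p ∈ stdSimplex ℝ (Option ι) := by
  refine ⟨?_, by simp [Fintype.sum_option, outcomeLaw]⟩
  rintro (_ | j)
  exacts [sub_nonneg.2 hp1, hp j]

lemma outcomeLaw_zero {ι : Type*} [Fintype ι] [DecidableEq ι] :
    outcomeLaw (0 : ι → ℝ) = Pi.single none 1 := by
  ext (_ | j) <;> simp [outcomeLaw]

lemma outcomeLaw_single {ι : Type*} [Fintype ι] [DecidableEq ι] (j : ι) :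
    outcomeLaw (Pi.single j 1 : ι → ℝ) = Pi.single (some j) 1 := by
  ext (_ | l) <;> simp [outcomeLaw, Pi.single_apply]

lemma outcomeLaw_mixture {ι κ : Type*} [Fintype ι] [Fintype κ] {τ : κ → ℝ} (hτ : ∑ s, τ s = 1)
    (P : κ → ι → ℝ) : outcomeLaw (fun j => ∑ s, τ s * P s j) = ∑ s, τ s • outcomeLaw (P s) := by
  ext (_ | j)
  · simp only [outcomeLaw, Option.elim, Finset.sum_apply, Pi.smul_apply, smul_eq_mul, mul_sub,
      mul_one, Finset.sum_sub_distrib, hτ, Finset.mul_sum]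
    rw [Finset.sum_comm]
  · simp [outcomeLaw]

variable {N : ℕ} {x : Fin N → ℝ} {i : Fin N} {w : Option (Fin N)}

/-- The payoff of buyer `i` over both periods, before payments to the first seller, when `w` says
who got the first unit. -/
def outcomeValue (x : Fin N → ℝ) (i : Fin N) (w : Option (Fin N)) : ℝ :=
  if w = some i then x i else secondPeriodPayoff x i w

lemma outcomeValue_self : outcomeValue x i (some i) = x i := if_pos rfl

lemma outcomeValue_of_ne (hw : w ≠ some i) : outcomeValue x i w = secondPeriodPayoff x i w :=
  if_neg hw

lemma grossPayoff_eq_dotProduct (p : Fin N → ℝ) :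
    grossPayoff p x i = outcomeLaw p ⬝ᵥ outcomeValue x i := by
  have hne : ∀ j ∈ Finset.univ.erase i,
      p j * outcomeValue x i (some j) = p j * secondPeriodPayoff x i (some j) := fun j hj => by
    rw [outcomeValue_of_ne (by simpa using Finset.ne_of_mem_erase hj)]
  rw [outcomeLaw_dotProduct, ← Finset.add_sum_erase _ (fun j => p j * outcomeValue x i (some j))
    (Finset.mem_univ i), outcomeValue_self, outcomeValue_of_ne (Option.some_ne_none i).symm,
    Finset.sum_congr rfl hne, grossPayoff, add_comm]

/-- The indicator that buyer `i` gets one of the two units when `w` says who got the first unit.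
The second unit counts only if `i` wins it without a tie. -/
def getsUnit (x : Fin N → ℝ) (i : Fin N) (w : Option (Fin N)) : ℝ :=
  if w = some i ∨ rivalMax x i w < x i then 1 else 0

lemma getsUnit_mem_Icc : getsUnit x i w ∈ Icc (0 : ℝ) 1 := by
  unfold getsUnit
  split_ifs <;> simp

lemma outcomeValue_mem_Icc (hx : ∀ j, 0 ≤ x j) : outcomeValue x i w ∈ Icc 0 (x i) := by
  unfold outcomeValue
  split_ifs
  exacts [⟨hx i, le_rfl⟩, ⟨secondPeriodPayoff_nonneg, secondPeriodPayoff_le hx⟩]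

lemma outcomeValue_add_getsUnit_mul_le (v : ℝ) :
    outcomeValue x i w + getsUnit x i w * (v - x i) ≤ outcomeValue (Function.update x i v) i w := by
  by_cases hw : w = some i
  · simp [outcomeValue, getsUnit, hw]
  · simp only [outcomeValue, getsUnit, hw, false_or, if_false, secondPeriodPayoff_eq,
      rivalMax_update, Function.update_self]
    split_ifs with h
    · rw [max_eq_left (by linarith)]
      exact le_max_of_le_left (by linarith)
    · rw [max_eq_right (by linarith)]
      simp

end Outcome

/-! ### Thresholds -/

section Threshold

variable {ψ : ℝ → EReal} {lo hi x y : ℝ}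

/-- The set whose minimum is `threshold ψ lo hi x`. -/
def thresholdSet (ψ : ℝ → EReal) (lo hi x : ℝ) : Set ℝ :=
  {a : ℝ | a ∈ Icc lo hi ∧ x ≤ a ∧ (x : EReal) ≤ (a : EReal) + ψ a}

lemma bddBelow_thresholdSet : BddBelow (thresholdSet ψ lo hi x) := ⟨lo, fun _ h => h.1.1⟩

lemma threshold_le_of_mem (h : y ∈ thresholdSet ψ lo hi x) : threshold ψ lo hi x ≤ y :=
  csInf_le bddBelow_thresholdSet h

lemma le_threshold (h : (thresholdSet ψ lo hi x).Nonempty) : x ≤ threshold ψ lo hi x :=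
  le_csInf h fun _ ha => ha.2.1

lemma threshold_mem_Icc (h : (thresholdSet ψ lo hi x).Nonempty) :
    threshold ψ lo hi x ∈ Icc lo hi := by
  refine ⟨le_csInf h fun a ha => ha.1.1, ?_⟩
  obtain ⟨a, ha⟩ := h
  exact (threshold_le_of_mem ha).trans ha.1.2

lemma mem_thresholdSet (hx : x ≤ y) (hy : y ∈ Icc lo hi) (h : 0 ≤ ψ y) :
    y ∈ thresholdSet ψ lo hi x := by
  refine ⟨hy, hx, ?_⟩
  calc (x : EReal) ≤ y + 0 := by simpa using hx
    _ ≤ y + ψ y := by gcongr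

lemma threshold_eq_self (hx : x ∈ Icc lo hi) (h : 0 ≤ ψ x) : threshold ψ lo hi x = x := by
  have hmem := mem_thresholdSet le_rfl hx h
  exact le_antisymm (threshold_le_of_mem hmem) (le_threshold ⟨x, hmem⟩)

lemma thresholdSet_nonempty (h : 0 ≤ ψ hi) (hx : x ∈ Icc lo hi) :
    (thresholdSet ψ lo hi x).Nonempty :=
  ⟨hi, mem_thresholdSet hx.2 ⟨hx.1.trans hx.2, le_rfl⟩ h⟩

end Threshold

/-! ### Ex post incentives -/

section ExPost

variable {N : ℕ} {ψ : ℝ → EReal} {lo hi : ℝ} {σ : Equiv.Perm (Fin N)} {b x : Fin N → ℝ}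
  {i j k : Fin N}

/-- The modified third-price auction in which ties are broken by the given priority order. -/
def priorityAuction (ψ : ℝ → EReal) (lo hi : ℝ) (σ : Equiv.Perm (Fin N)) : Mechanism N where
  alloc := thirdPriceAlloc ψ lo hi σ
  pay := thirdPricePay ψ lo hi σ

open Classical in
lemma outcomeLaw_thirdPriceAlloc (hj : position σ b j = 2) :
    outcomeLaw (thirdPriceAlloc ψ lo hi σ b)
      = Pi.single (if IsAllocated ψ lo hi b then some j else none) 1 := by
  by_cases h : IsAllocated ψ lo hi b
  · have halloc : thirdPriceAlloc ψ lo hi σ b = Pi.single j 1 := by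
      ext i
      simp only [thirdPriceAlloc, h, true_and, ← hj, position_injective.eq_iff, Pi.single_apply]
    rw [halloc, outcomeLaw_single, if_pos h]
  · have halloc : thirdPriceAlloc ψ lo hi σ b = 0 := by
      ext i
      simp [thirdPriceAlloc, h]
    rw [halloc, outcomeLaw_zero, if_neg h]

open Classical in
lemma grossPayoff_thirdPriceAlloc (hj : position σ b j = 2) :
    grossPayoff (thirdPriceAlloc ψ lo hi σ b) x i
      = outcomeValue x i (if IsAllocated ψ lo hi b then some j else none) := by
  rw [grossPayoff_eq_dotProduct, outcomeLaw_thirdPriceAlloc hj, single_one_dotProduct]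

lemma AreTopThree.isAllocated_iff (h : AreTopThree σ b i j k) :
    IsAllocated ψ lo hi b ↔ threshold ψ lo hi (b k) ≤ b j := by
  rw [IsAllocated, h.kthHighest_two, h.kthHighest_three]

/- Where `0 ≤ ψ (b k)`, the threshold of `b k` is `b k` itself, so that the two payment rules of the
auction agree. -/
open Classical in
lemma AreTopThree.thirdPricePay_first (h : AreTopThree σ b i j k) (hk : b k ∈ Icc lo hi) :
    thirdPricePay ψ lo hi σ b i
      = if threshold ψ lo hi (b k) ≤ b j then threshold ψ lo hi (b k) - b k else 0 := by
  simp only [thirdPricePay, h.isAllocated_iff, h.kthHighest_three, h.position_first, if_true]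
  congr 1
  split_ifs with hψ
  · rfl
  · rw [threshold_eq_self hk (not_lt.1 hψ), sub_self]

open Classical in
lemma AreTopThree.thirdPricePay_second (h : AreTopThree σ b i j k) (hk : b k ∈ Icc lo hi) :
    thirdPricePay ψ lo hi σ b j
      = if threshold ψ lo hi (b k) ≤ b j then threshold ψ lo hi (b k) else 0 := by
  simp only [thirdPricePay, h.isAllocated_iff, h.kthHighest_three, h.position_second, if_true,
    OfNat.ofNat_ne_one, if_false]
  congr 1
  split_ifs with hψ
  · rfl
  · rw [threshold_eq_self hk (not_lt.1 hψ)]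

lemma thirdPricePay_of_two_lt_position (h : 2 < position σ b i) :
    thirdPricePay ψ lo hi σ b i = 0 := by
  rw [thirdPricePay, if_neg (by lia : ¬ position σ b i = 1),
    if_neg (by lia : ¬ position σ b i = 2), ite_self]

namespace AreTopRivals

variable {q : ℝ}

lemma payoff_update_first (h : AreTopRivals σ x i j k) (hk : x k ∈ Icc lo hi)
    (hij : RankedAbove σ (Function.update x i q) i j) :
    payoff (priorityAuction ψ lo hi σ) (Function.update x i q) x i
      = if threshold ψ lo hi (x k) ≤ x j then
          max (x i - x k) 0 - (threshold ψ lo hi (x k) - x k)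
        else max (x i - x j) 0 := by
  have ht : AreTopThree σ (Function.update x i q) i j k :=
    ⟨hij, (h.update q).first, (h.update q).rest⟩
  have hpay := ht.thirdPricePay_first (ψ := ψ) (lo := lo) (hi := hi)
  have halloc := ht.isAllocated_iff (ψ := ψ) (lo := lo) (hi := hi)
  simp only [Function.update_of_ne h.fst_ne, Function.update_of_ne h.snd_ne] at hpay halloc
  simp only [payoff, priorityAuction, grossPayoff_thirdPriceAlloc ht.position_second, hpay hk,
    halloc]
  split_ifs with ha
  · rw [outcomeValue_of_ne (by simpa using h.fst_ne), h.secondPeriodPayoff_some_first]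
  · rw [outcomeValue_of_ne (by simp), h.secondPeriodPayoff_eq (by simp), sub_zero]

lemma payoff_update_second (h : AreTopRivals σ x i j k) (hk : x k ∈ Icc lo hi)
    (hji : RankedAbove σ (Function.update x i q) j i)
    (hik : RankedAbove σ (Function.update x i q) i k) :
    payoff (priorityAuction ψ lo hi σ) (Function.update x i q) x i
      = if threshold ψ lo hi (x k) ≤ q then x i - threshold ψ lo hi (x k)
        else max (x i - x j) 0 := by
  have ht : AreTopThree σ (Function.update x i q) j i k :=
    ⟨hji, hik, fun l hj hi => (h.update q).rest l hi hj⟩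
  have hpay := ht.thirdPricePay_second (ψ := ψ) (lo := lo) (hi := hi)
  have halloc := ht.isAllocated_iff (ψ := ψ) (lo := lo) (hi := hi)
  simp only [Function.update_self, Function.update_of_ne h.snd_ne] at hpay halloc
  simp only [payoff, priorityAuction, grossPayoff_thirdPriceAlloc ht.position_second, hpay hk,
    halloc]
  split_ifs with ha
  · rw [outcomeValue_self]
  · rw [outcomeValue_of_ne (by simp), h.secondPeriodPayoff_eq (by simp), sub_zero]

lemma payoff_update_low (h : AreTopRivals σ x i j k)
    (hki : RankedAbove σ (Function.update x i q) k i) :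
    payoff (priorityAuction ψ lo hi σ) (Function.update x i q) x i = max (x i - x j) 0 := by
  have hk : position σ (Function.update x i q) k = 2 :=
    position_eq_two (h.update q).first fun l hlj hlk => by
      by_cases hli : l = i
      · exact hli ▸ hki
      · exact (h.update q).rest l hli hlj hlk
  simp only [payoff, priorityAuction, grossPayoff_thirdPriceAlloc hk,
    thirdPricePay_of_two_lt_position (hk ▸ position_lt_position hki), sub_zero]
  split_ifs
  · rw [outcomeValue_of_ne (by simpa using hki.ne),
      h.secondPeriodPayoff_eq (by simpa using h.first.ne.symm)]
  · rw [outcomeValue_of_ne (by simp), h.secondPeriodPayoff_eq (by simp)]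

lemma payoff_update_le (h : AreTopRivals σ x i j k) (hk : x k ∈ Icc lo hi)
    (hak : x k ≤ threshold ψ lo hi (x k)) :
    payoff (priorityAuction ψ lo hi σ) (Function.update x i q) x i
      ≤ max (x i - min (threshold ψ lo hi (x k)) (x j)) 0 := by
  have hlow : max (x i - x j) 0 ≤ max (x i - min (threshold ψ lo hi (x k)) (x j)) 0 := by
    gcongr
    exact min_le_right _ _
  rcases rankedAbove_or_rankedAbove h.fst_ne with hji | hij
  · rcases rankedAbove_or_rankedAbove h.snd_ne with hki | hik
    · exact (h.payoff_update_low hki).trans_le hlow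
    · rw [h.payoff_update_second hk hji hik]
      split_ifs
      · exact le_max_of_le_left (by gcongr; exact min_le_left _ _)
      · exact hlow
  · rw [h.payoff_update_first hk hij]
    split_ifs with ha
    · rw [min_eq_left ha, ← max_sub_sub_right]
      exact max_le_max (by linarith) (by linarith)
    · exact hlow

lemma payoff_truthful (h : AreTopRivals σ x i j k) (hk : x k ∈ Icc lo hi)
    (hak : x k ≤ threshold ψ lo hi (x k)) :
    payoff (priorityAuction ψ lo hi σ) x x i
      = max (x i - min (threshold ψ lo hi (x k)) (x j)) 0 := by
  have hkj := h.first.le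
  have hlow := h.payoff_update_low (ψ := ψ) (lo := lo) (hi := hi) (q := x i)
  have hsecond := h.payoff_update_second (ψ := ψ) (q := x i) hk
  have hfirst := h.payoff_update_first (ψ := ψ) (q := x i) hk
  rw [Function.update_eq_self] at hlow hsecond hfirst
  rcases rankedAbove_or_rankedAbove h.fst_ne with hji | hij
  · rcases rankedAbove_or_rankedAbove h.snd_ne with hki | hik
    · rw [hlow hki, max_eq_right (by linarith [hki.le]), max_eq_right]
      linarith [le_min hak hkj, hki.le]
    · rw [hsecond hji hik]
      split_ifs with ha
      · rw [min_eq_left (ha.trans hji.le), max_eq_left (sub_nonneg.2 ha)]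
      · rw [max_eq_right (sub_nonpos.2 hji.le), max_eq_right]
        exact sub_nonpos.2 (le_min (not_le.1 ha).le hji.le)
  · have hji := hij.le
    rw [hfirst hij]
    split_ifs with ha
    · rw [min_eq_left ha, max_eq_left (by linarith), max_eq_left (by linarith)]
      ring
    · rw [min_eq_right (not_le.1 ha).le]

end AreTopRivals

section PriorityAuction

variable (hN : 3 ≤ N) (hψ : 0 ≤ ψ hi) (hx : ∀ l, x l ∈ Icc lo hi)

include hN hψ hx

lemma payoff_priorityAuction_update_le (q : ℝ) :
    payoff (priorityAuction ψ lo hi σ) (Function.update x i q) x i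
      ≤ payoff (priorityAuction ψ lo hi σ) x x i := by
  obtain ⟨j, k, h⟩ := exists_areTopRivals hN σ x i
  have hak := le_threshold (thresholdSet_nonempty hψ (hx k))
  exact (h.payoff_update_le (hx k) hak).trans_eq (h.payoff_truthful (hx k) hak).symm

lemma secondPeriodPayoff_none_le_payoff_priorityAuction :
    secondPeriodPayoff x i none ≤ payoff (priorityAuction ψ lo hi σ) x x i := by
  obtain ⟨j, k, h⟩ := exists_areTopRivals hN σ x i
  rw [h.payoff_truthful (hx k) (le_threshold (thresholdSet_nonempty hψ (hx k))),
    h.secondPeriodPayoff_eq (by simp)]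
  gcongr
  exact min_le_right _ _

lemma payoff_priorityAuction_eq_zero (hi0 : x i = lo) :
    payoff (priorityAuction ψ lo hi σ) x x i = 0 := by
  obtain ⟨j, k, h⟩ := exists_areTopRivals hN σ x i
  have hne := thresholdSet_nonempty hψ (hx k)
  rw [h.payoff_truthful (hx k) (le_threshold hne), hi0, max_eq_right]
  exact sub_nonpos.2 (le_min (threshold_mem_Icc hne).1 (hx j).1)

end PriorityAuction

section RandomPriority

variable {τ : Equiv.Perm (Fin N) → ℝ}

lemma payoff_modifiedThirdPriceAuction (hτ : ∑ σ, τ σ = 1) :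
    payoff (modifiedThirdPriceAuction ψ lo hi τ) b x i
      = ∑ σ, τ σ * payoff (priorityAuction ψ lo hi σ) b x i := by
  simp only [payoff, grossPayoff_eq_dotProduct, modifiedThirdPriceAuction, priorityAuction,
    outcomeLaw_mixture hτ, sum_dotProduct, smul_dotProduct, smul_eq_mul, mul_sub,
    Finset.sum_sub_distrib]

theorem isExPostEquilibrium_modifiedThirdPriceAuction (hN : 3 ≤ N) (hψ : 0 ≤ ψ hi)
    (hτ : τ ∈ stdSimplex ℝ (Equiv.Perm (Fin N))) :
    IsExPostEquilibrium lo hi (modifiedThirdPriceAuction ψ lo hi τ) (truthful N) := by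
  intro x hx i q _
  simp only [truthful, payoff_modifiedThirdPriceAuction hτ.2]
  gcongr with σ
  exacts [hτ.1 σ, payoff_priorityAuction_update_le hN hψ hx q]

lemma secondPeriodPayoff_none_le_payoff (hN : 3 ≤ N) (hψ : 0 ≤ ψ hi)
    (hτ : τ ∈ stdSimplex ℝ (Equiv.Perm (Fin N))) (hx : ∀ l, x l ∈ Icc lo hi) :
    secondPeriodPayoff x i none ≤ payoff (modifiedThirdPriceAuction ψ lo hi τ) x x i := by
  rw [payoff_modifiedThirdPriceAuction hτ.2]
  exact dotProduct_mem_of_mem_stdSimplex (convex_Ici _) hτ fun σ =>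
    secondPeriodPayoff_none_le_payoff_priorityAuction hN hψ hx

lemma payoff_modifiedThirdPriceAuction_eq_zero (hN : 3 ≤ N) (hψ : 0 ≤ ψ hi)
    (hτ : ∑ σ, τ σ = 1) (hx : ∀ l, x l ∈ Icc lo hi) (hi0 : x i = lo) :
    payoff (modifiedThirdPriceAuction ψ lo hi τ) x x i = 0 := by
  simp only [payoff_modifiedThirdPriceAuction hτ, payoff_priorityAuction_eq_zero hN hψ hx hi0,
    mul_zero, Finset.sum_const_zero]

end RandomPriority

end ExPost

/-! ### Resampling one coordinate -/

section Resample

variable {ι : Type*} [Fintype ι] {X : ι → Type*} [∀ i, MeasurableSpace (X i)]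
  {μ : ∀ i, Measure (X i)} [∀ i, IsProbabilityMeasure (μ i)]

lemma ae_forall_mem {s : ∀ i, Set (X i)} (hs : ∀ i, ∀ᵐ v ∂μ i, v ∈ s i) :
    ∀ᵐ x ∂Measure.pi μ, ∀ i, x i ∈ s i :=
  ae_all_iff.2 fun i => (Measure.quasiMeasurePreserving_eval μ i).ae (hs i)

variable [DecidableEq ι]

lemma measurePreserving_update (i : ι) :
    MeasurePreserving (fun p : (∀ i, X i) × X i => Function.update p.1 i p.2)
      ((Measure.pi μ).prod (μ i)) (Measure.pi μ) := by
  refine ⟨measurable_update', (Measure.pi_eq fun s hs => ?_).symm⟩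
  have hpre : (fun p : (∀ i, X i) × X i => Function.update p.1 i p.2) ⁻¹' (univ.pi s)
      = (univ.pi (Function.update s i univ)) ×ˢ s i := by
    ext ⟨x, q⟩
    simp only [mem_preimage, mem_univ_pi, mem_prod, mem_univ, true_and, and_comm,
      Function.forall_update_iff x (fun j y => y ∈ s j),
      Function.forall_update_iff s (fun j t => x j ∈ t)]
  rw [Measure.map_apply measurable_update' (MeasurableSet.univ_pi hs), hpre, Measure.prod_prod,
    Measure.pi_pi, ← Finset.prod_erase_mul _ _ (Finset.mem_univ i),
    ← Finset.prod_erase_mul Finset.univ (fun j => μ j (s j)) (Finset.mem_univ i),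
    Function.update_self, measure_univ, mul_one]
  congr 1
  refine Finset.prod_congr rfl fun j hj => ?_
  rw [Function.update_of_ne (Finset.ne_of_mem_erase hj)]

lemma ae_forall_update_mem {s : ∀ i, Set (X i)} (hs : ∀ i, ∀ᵐ v ∂μ i, v ∈ s i) {i : ι} {q : X i}
    (hq : q ∈ s i) : ∀ᵐ x ∂Measure.pi μ, ∀ j, Function.update x i q j ∈ s j := by
  filter_upwards [ae_forall_mem hs] with x hx
  exact (Function.forall_update_iff x fun j y => y ∈ s j).2 ⟨hq, fun j _ => hx j⟩

lemma integrable_integral_update {g : (∀ i, X i) → ℝ} (hg : Integrable g (Measure.pi μ)) (i : ι) :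
    Integrable (fun q => ∫ x, g (Function.update x i q) ∂Measure.pi μ) (μ i) :=
  ((measurePreserving_update i).integrable_comp_of_integrable hg).integral_prod_right

lemma integral_integral_update {g : (∀ i, X i) → ℝ} (hg : Integrable g (Measure.pi μ)) (i : ι) :
    ∫ q, ∫ x, g (Function.update x i q) ∂Measure.pi μ ∂μ i = ∫ x, g x ∂Measure.pi μ := by
  have hmp := measurePreserving_update (μ := μ) i
  have hint : Integrable (fun p : (∀ i, X i) × X i => g (Function.update p.1 i p.2))
      ((Measure.pi μ).prod (μ i)) := hmp.integrable_comp_of_integrable hg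
  have hg' : AEStronglyMeasurable g (((Measure.pi μ).prod (μ i)).map
      fun p : (∀ i, X i) × X i => Function.update p.1 i p.2) := by
    rw [hmp.map_eq]; exact hg.1
  rw [← integral_prod_symm _ hint, ← integral_map hmp.measurable.aemeasurable hg', hmp.map_eq]

omit [DecidableEq ι] in
lemma ae_ne_of_measurable {i j : ι} (hij : i ≠ j) [MeasurableEq (X i)]
    [NullSingletonClass (μ i)] {g : X j → X i} (hg : Measurable g) :
    ∀ᵐ x ∂Measure.pi μ, x i ≠ g (x j) := by
  classical
  have hmp := measurePreserving_update (μ := μ) i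
  have hmeas : MeasurableSet {x : ∀ i, X i | x i ≠ g (x j)} :=
    (measurableSet_eq_fun (measurable_pi_apply i) (hg.comp (measurable_pi_apply j))).compl
  rw [← hmp.map_eq, ae_map_iff hmp.measurable.aemeasurable hmeas]
  refine (Measure.ae_prod_iff_ae_ae (hmp.measurable hmeas)).2 (.of_forall fun x => ?_)
  simpa only [mem_ofPred_eq, Function.update_self, Function.update_of_ne hij.symm]
    using Measure.ae_ne (μ i) (g (x j))

end Resample

/-! ### The envelope formula -/

/-- At each point of `s`, the slope `D` is a subgradient of `U` relative to `s`. An incentive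
compatible payoff and the corresponding probability of winning are related in this way. -/
def IsSubgradientOn (U D : ℝ → ℝ) (s : Set ℝ) : Prop :=
  ∀ x ∈ s, ∀ y ∈ s, U x + D x * (y - x) ≤ U y

namespace IsSubgradientOn

variable {U D : ℝ → ℝ} {s : Set ℝ} {a b x : ℝ}

lemma monotoneOn (h : IsSubgradientOn U D s) : MonotoneOn D s := by
  intro x hx y hy hxy
  rcases hxy.eq_or_lt with rfl | hlt
  · exact le_rfl
  · nlinarith [h x hx y hy, h y hy x hx]

lemma continuousOn (h : IsSubgradientOn U D (Icc a b)) : ContinuousOn U (Icc a b) := by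
  rcases le_or_gt a b with hab | hab
  swap
  · simp [Icc_eq_empty hab.not_ge]
  have hbound : ∀ x ∈ Icc a b, |D x| ≤ max |D a| |D b| := fun x hx =>
    abs_le_max_abs_abs (h.monotoneOn ⟨le_rfl, hab⟩ hx hx.1) (h.monotoneOn hx ⟨hab, le_rfl⟩ hx.2)
  have hle : ∀ x ∈ Icc a b, ∀ y ∈ Icc a b, U x - U y ≤ max |D a| |D b| * |x - y| := by
    intro x hx y hy
    calc U x - U y ≤ D x * (x - y) := by linarith [h x hx y hy]
      _ ≤ |D x| * |x - y| := (le_abs_self _).trans_eq (abs_mul _ _)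
      _ ≤ max |D a| |D b| * |x - y| := by gcongr; exact hbound x hx
  refine (LipschitzOnWith.of_le_add_mul (Real.toNNReal (max |D a| |D b|)) ?_).continuousOn
  intro x hx y hy
  rw [Real.coe_toNNReal _ (by positivity), Real.dist_eq]
  linarith [hle x hx y hy]

lemma hasDerivAt (h : IsSubgradientOn U D s) (hs : s ∈ nhds x) (hD : ContinuousAt D x) :
    HasDerivAt U (D x) x := by
  rw [hasDerivAt_iff_isLittleO, Asymptotics.isLittleO_iff]
  intro c hc
  filter_upwards [Metric.continuousAt_iff'.1 hD c hc, hs] with y hy hys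
  have hx := mem_of_mem_nhds hs
  have hlow : 0 ≤ U y - U x - (y - x) * D x := by linarith [h x hx y hys]
  rw [smul_eq_mul, Real.norm_eq_abs, Real.norm_eq_abs, abs_of_nonneg hlow]
  calc U y - U x - (y - x) * D x ≤ (D y - D x) * (y - x) := by linarith [h y hys x hx]
    _ ≤ |D y - D x| * |y - x| := (le_abs_self _).trans_eq (abs_mul _ _)
    _ ≤ c * |y - x| := by gcongr; exact hy.le

lemma integral_eq_sub (h : IsSubgradientOn U D (Icc a b)) (hab : a ≤ b) :
    ∫ x in a..b, D x = U b - U a := by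
  refine integral_eq_of_hasDerivAt_off_countable_of_le U D hab
    h.monotoneOn.countable_not_continuousWithinAt h.continuousOn (fun x hx => ?_) ?_
  · have hs : Icc a b ∈ nhds x := Icc_mem_nhds hx.1.1 hx.1.2
    refine h.hasDerivAt hs (ContinuousWithinAt.continuousAt ?_ hs)
    by_contra hD
    exact hx.2 ⟨Ioo_subset_Icc_self hx.1, hD⟩
  · exact MonotoneOn.intervalIntegrable (uIcc_of_le hab ▸ h.monotoneOn)

lemma mono {t : Set ℝ} (h : IsSubgradientOn U D s) (hts : t ⊆ s) : IsSubgradientOn U D t :=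
  fun x hx y hy => h x (hts hx) y (hts hy)

end IsSubgradientOn

/-! ### The distribution of values -/

section Distribution

variable {μ : Measure ℝ} {f : ℝ → ℝ} {lo hi : ℝ}

/-- The inverse hazard rate `(1 - F) / f`, the rent per unit of winning probability that a buyer
keeps because his value is private. It is `0` where `f = 0`. -/
def invHazard (μ : Measure ℝ) (f : ℝ → ℝ) (x : ℝ) : ℝ := (1 - cdf μ x) / f x

lemma virtualValue_eq {x : ℝ} (hf : 0 < f x) :
    virtualValue μ f x = ((x - invHazard μ f x : ℝ) : EReal) := by
  have hnonneg : 0 ≤ (1 - cdf μ x) / f x := div_nonneg (sub_nonneg.2 (cdf_le_one μ x)) hf.le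
  rw [virtualValue, ← ENNReal.ofReal_div_of_pos hf, EReal.coe_ennreal_ofReal, max_eq_left hnonneg,
    invHazard, EReal.coe_sub]

lemma integral_intervalIntegral_eq_setIntegral_mul [IsProbabilityMeasure μ]
    (hμ : ∀ᵐ v ∂μ, v ∈ Icc lo hi) {D : ℝ → ℝ} (hD : IntegrableOn D (Ioo lo hi)) :
    ∫ v, (∫ s in lo..v, D s) ∂μ = ∫ s in Ioo lo hi, D s * (1 - cdf μ s) := by
  have hinner : ∀ᵐ v ∂μ, ∫ s in lo..v, D s = ∫ s in Ioo lo hi, (Iio v).indicator D s := by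
    filter_upwards [hμ] with v hv
    rw [intervalIntegral.integral_of_le hv.1, integral_Ioc_eq_integral_Ioo,
      setIntegral_indicator measurableSet_Iio, Ioo_inter_Iio, min_eq_right hv.2]
  have hint : Integrable (Function.uncurry fun v s => (Iio v).indicator D s)
      (μ.prod (volume.restrict (Ioo lo hi))) :=
    (hD.integrable.comp_snd μ).indicator (measurableSet_lt measurable_snd measurable_fst)
  rw [integral_congr_ae hinner, integral_integral_swap hint]
  congr 1 with s
  calc ∫ v, (Iio v).indicator D s ∂μ = ∫ v, (Ioi s).indicator (fun _ => D s) v ∂μ := rfl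
    _ = D s * (1 - cdf μ s) := by
      rw [integral_indicator_const _ measurableSet_Ioi, smul_eq_mul, ← compl_Iic,
        measureReal_compl measurableSet_Iic, probReal_univ, cdf_eq_real, mul_comm]

/-- `μ` is a distribution of buyer values with support `[lo, hi]`, `lo ≥ 0`, and measurable density
`f`, which may jump, unlike in `IsValueDistribution`. -/
structure HasValueDensity (μ : Measure ℝ) (f : ℝ → ℝ) (lo hi : ℝ) : Prop where
  isProbabilityMeasure : IsProbabilityMeasure μ
  lo_nonneg : 0 ≤ lo
  support_eq : μ.support = Icc lo hi
  density_nonneg : ∀ x, 0 ≤ f x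
  density_eq_zero : ∀ x, x ∉ Icc lo hi → f x = 0
  measurable_density : Measurable f
  eq_withDensity : μ = volume.withDensity (fun x => ENNReal.ofReal (f x))

lemma IsValueDistribution.hasValueDensity (h : IsValueDistribution μ f lo hi) :
    HasValueDensity μ f lo hi where
  __ := h
  measurable_density := by
    classical
    have hf : f = (Icc lo hi).piecewise f (fun _ => 0) := by
      ext x
      by_cases hx : x ∈ Icc lo hi
      · rw [piecewise_eq_of_mem _ _ _ hx]
      · rw [piecewise_eq_of_notMem _ _ _ hx, h.density_eq_zero x hx]
    rw [hf]
    exact h.density_continuousOn.measurable_piecewise continuousOn_const measurableSet_Icc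

namespace HasValueDensity

lemma ae_mem_Icc (h : HasValueDensity μ f lo hi) : ∀ᵐ v ∂μ, v ∈ Icc lo hi := by
  have := Measure.support_mem_ae (μ := μ)
  rwa [h.support_eq] at this

lemma nullSingletonClass (h : HasValueDensity μ f lo hi) : NullSingletonClass μ := by
  rw [h.eq_withDensity]
  infer_instance

lemma ae_mem_Ioo (h : HasValueDensity μ f lo hi) : ∀ᵐ v ∂μ, v ∈ Ioo lo hi := by
  have := h.nullSingletonClass
  filter_upwards [h.ae_mem_Icc, Measure.ae_ne μ lo, Measure.ae_ne μ hi] with v hv hlo hhi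
  exact ⟨hv.1.lt_of_ne' hlo, hv.2.lt_of_ne hhi⟩

lemma lo_lt_hi (h : HasValueDensity μ f lo hi) : lo < hi := by
  have := h.isProbabilityMeasure
  obtain ⟨v, hv⟩ := h.ae_mem_Ioo.exists
  exact hv.1.trans hv.2

lemma cdf_lt_one (h : HasValueDensity μ f lo hi) {x : ℝ} (hx : x < hi) : cdf μ x < 1 := by
  have := h.isProbabilityMeasure
  have hmem : hi ∈ μ.support := h.support_eq ▸ ⟨h.lo_lt_hi.le, le_rfl⟩
  have hpos : 0 < μ (Ioi x) := (Measure.mem_support_iff_forall hi).1 hmem _ (Ioi_mem_nhds hx)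
  have hreal : 0 < μ.real (Ioi x) := ENNReal.toReal_pos hpos.ne' (measure_ne_top _ _)
  rw [← compl_Iic, measureReal_compl measurableSet_Iic, probReal_univ, ← cdf_eq_real] at hreal
  linarith

lemma virtualValue_eq_bot (h : HasValueDensity μ f lo hi) {x : ℝ} (hx : x < hi)
    (hf : f x = 0) : virtualValue μ f x = ⊥ := by
  have hcdf : ENNReal.ofReal (1 - cdf μ x) ≠ 0 := by simpa using h.cdf_lt_one hx
  simp [virtualValue, hf, ENNReal.div_zero hcdf]

lemma virtualValue_hi (h : HasValueDensity μ f lo hi) : virtualValue μ f hi = hi := by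
  have := h.isProbabilityMeasure
  have hIic : μ (Iic hi) = 1 := by
    rw [← mem_ae_iff_prob_eq_one measurableSet_Iic]
    filter_upwards [h.ae_mem_Icc] with v hv using hv.2
  simp [virtualValue, cdf_eq_real, Measure.real, hIic]

lemma virtualValue_hi_nonneg (h : HasValueDensity μ f lo hi) : 0 ≤ virtualValue μ f hi := by
  rw [h.virtualValue_hi]
  exact_mod_cast h.lo_nonneg.trans h.lo_lt_hi.le

lemma density_pos (h : HasValueDensity μ f lo hi)
    (hψ : MonotoneOn (virtualValue μ f) (Icc lo hi)) {x : ℝ} (hx : x ∈ Ioo lo hi) : 0 < f x := by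
  refine (h.density_nonneg x).lt_of_ne' fun hfx => ?_
  have hzero : ∀ y ≤ x, f y = 0 := by
    intro y hy
    by_contra hfy
    have hpos : 0 < f y := (h.density_nonneg y).lt_of_ne' hfy
    have hmem : y ∈ Icc lo hi := not_imp_comm.1 (h.density_eq_zero y) hfy
    have hle := hψ hmem (Ioo_subset_Icc_self hx) hy
    rw [h.virtualValue_eq_bot hx.2 hfx, virtualValue_eq hpos] at hle
    exact EReal.coe_ne_bot _ (le_bot_iff.1 hle)
  have hmem : lo ∈ μ.support := h.support_eq ▸ ⟨le_rfl, h.lo_lt_hi.le⟩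
  have hpos : 0 < μ (Iio x) := (Measure.mem_support_iff_forall lo).1 hmem _ (Iio_mem_nhds hx.1)
  rw [h.eq_withDensity, withDensity_apply _ measurableSet_Iio,
    setLIntegral_congr_fun (g := fun _ => 0) measurableSet_Iio
      (fun y hy => by simp [hzero y hy.le])] at hpos
  simp at hpos

lemma measurable_invHazard (h : HasValueDensity μ f lo hi) : Measurable (invHazard μ f) :=
  (measurable_const.sub (monotone_cdf μ).measurable).div h.measurable_density

lemma integral_eq_setIntegral_mul_density (h : HasValueDensity μ f lo hi) (g : ℝ → ℝ) :
    ∫ v, g v ∂μ = ∫ v in Ioo lo hi, g v * f v := by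
  rw [← integral_Icc_eq_integral_Ioo, setIntegral_eq_integral_of_forall_compl_eq_zero
    fun x hx => by rw [h.density_eq_zero x hx, mul_zero], h.eq_withDensity,
    integral_withDensity_eq_integral_toReal_smul h.measurable_density.ennreal_ofReal
      (.of_forall fun x => ENNReal.ofReal_lt_top)]
  congr 1 with x
  rw [ENNReal.toReal_ofReal (h.density_nonneg x), smul_eq_mul, mul_comm]

lemma integrable_invHazard (h : HasValueDensity μ f lo hi) : Integrable (invHazard μ f) μ := by
  rw [h.eq_withDensity, integrable_withDensity_iff_integrable_smul'
    h.measurable_density.ennreal_ofReal (.of_forall fun x => ENNReal.ofReal_lt_top),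
    ← h.eq_withDensity]
  have hbound : Integrable ((Icc lo hi).indicator fun _ : ℝ => (1 : ℝ)) :=
    IntegrableOn.integrable_indicator (integrable_const (1 : ℝ)) measurableSet_Icc
  refine hbound.mono' ?_ (.of_forall fun x => ?_)
  · exact (h.measurable_density.ennreal_ofReal.ennreal_toReal.smul
      h.measurable_invHazard).aestronglyMeasurable
  · rw [ENNReal.toReal_ofReal (h.density_nonneg x), smul_eq_mul, invHazard]
    by_cases hx : f x = 0
    · rw [hx]
      simp [indicator_nonneg]
    · have hmem : x ∈ Icc lo hi := not_imp_comm.1 (h.density_eq_zero x) hx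
      rw [mul_div_cancel₀ _ hx, indicator_of_mem hmem, Real.norm_eq_abs, abs_le]
      exact ⟨by linarith [cdf_le_one μ x], by linarith [cdf_nonneg μ x]⟩

lemma integral_intervalIntegral_eq_integral_mul_invHazard (h : HasValueDensity μ f lo hi)
    (hf : ∀ x ∈ Ioo lo hi, 0 < f x) {D : ℝ → ℝ} (hD : IntegrableOn D (Ioo lo hi)) :
    ∫ v, (∫ s in lo..v, D s) ∂μ = ∫ s, D s * invHazard μ f s ∂μ := by
  have := h.isProbabilityMeasure
  rw [integral_intervalIntegral_eq_setIntegral_mul h.ae_mem_Icc hD,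
    h.integral_eq_setIntegral_mul_density]
  refine setIntegral_congr_fun measurableSet_Ioo fun s hs => ?_
  rw [invHazard, mul_assoc, div_mul_cancel₀ _ (hf s hs).ne']

end HasValueDensity

end Distribution

/-! ### The revenue of incentive compatible mechanisms -/

section WinProb

variable {N : ℕ} {p x : Fin N → ℝ} {i : Fin N}

lemma grossPayoff_mem_Icc (hp : outcomeLaw p ∈ stdSimplex ℝ (Option (Fin N)))
    (hx : ∀ j, 0 ≤ x j) : grossPayoff p x i ∈ Icc 0 (x i) :=
  grossPayoff_eq_dotProduct (x := x) p ▸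
    dotProduct_mem_of_mem_stdSimplex (convex_Icc _ _) hp fun _ => outcomeValue_mem_Icc hx

/-- The probability that buyer `i` gets one of the two units when buyer `j` gets the first one with
probability `p j`. -/
def winProb (p x : Fin N → ℝ) (i : Fin N) : ℝ := outcomeLaw p ⬝ᵥ getsUnit x i

lemma winProb_mem_Icc (hp : outcomeLaw p ∈ stdSimplex ℝ (Option (Fin N))) :
    winProb p x i ∈ Icc (0 : ℝ) 1 :=
  dotProduct_mem_of_mem_stdSimplex (convex_Icc _ _) hp fun _ => getsUnit_mem_Icc

lemma grossPayoff_add_winProb_mul_le (hp : outcomeLaw p ∈ stdSimplex ℝ (Option (Fin N))) (v : ℝ) :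
    grossPayoff p x i + winProb p x i * (v - x i) ≤ grossPayoff p (Function.update x i v) i := by
  simp only [grossPayoff_eq_dotProduct, winProb, dotProduct, Finset.sum_mul,
    ← Finset.sum_add_distrib, mul_assoc, ← mul_add]
  gcongr with w
  exacts [hp.1 w, outcomeValue_add_getsUnit_mul_le v]

lemma measurable_rivalMax (i : Fin N) (w : Option (Fin N)) :
    Measurable fun x : Fin N → ℝ => rivalMax x i w :=
  Measurable.iSup fun _ => measurable_pi_apply _

lemma measurable_outcomeValue (i : Fin N) (w : Option (Fin N)) :
    Measurable fun x : Fin N → ℝ => outcomeValue x i w :=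
  Measurable.ite (.const _) (measurable_pi_apply i)
    (((measurable_pi_apply i).sub (measurable_rivalMax i w)).max measurable_const)

lemma measurable_getsUnit (i : Fin N) (w : Option (Fin N)) :
    Measurable fun x : Fin N → ℝ => getsUnit x i w :=
  Measurable.ite ((MeasurableSet.const _).union
    (measurableSet_lt (measurable_rivalMax i w) (measurable_pi_apply i)))
    measurable_const measurable_const

end WinProb

namespace IsDirectMechanism

variable {N : ℕ} {μ : Measure ℝ} {lo hi : ℝ} {M : Mechanism N} {i : Fin N}

lemma outcomeLaw_mem_stdSimplex (hM : IsDirectMechanism μ lo hi M) {b : Fin N → ℝ}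
    (hb : ∀ j, b j ∈ Icc lo hi) : outcomeLaw (M.alloc b) ∈ stdSimplex ℝ (Option (Fin N)) :=
  SequentialAuction.outcomeLaw_mem_stdSimplex (hM.alloc_nonneg b hb) (hM.sum_alloc_le_one b hb)

section

variable {α : Type*} [MeasurableSpace α] {ν : Measure α} {b x : α → Fin N → ℝ}

lemma measurable_outcomeLaw_dotProduct (hM : IsDirectMechanism μ lo hi M) (hb : Measurable b)
    {V : α → Option (Fin N) → ℝ} (hV : ∀ w, Measurable fun a => V a w) :
    Measurable fun a => outcomeLaw (M.alloc (b a)) ⬝ᵥ V a := by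
  have halloc : ∀ j, Measurable fun a => M.alloc (b a) j := fun j => (hM.measurable_alloc j).comp hb
  simp only [outcomeLaw_dotProduct]
  fun_prop

lemma measurable_winProb (hM : IsDirectMechanism μ lo hi M) (hx : Measurable x) :
    Measurable fun a => winProb (M.alloc (x a)) (x a) i :=
  hM.measurable_outcomeLaw_dotProduct hx fun w => (measurable_getsUnit i w).comp hx

lemma integrable_winProb [IsFiniteMeasure ν] (hM : IsDirectMechanism μ lo hi M)
    (hx : Measurable x) (hmem : ∀ᵐ a ∂ν, ∀ j, x a j ∈ Icc lo hi) :
    Integrable (fun a => winProb (M.alloc (x a)) (x a) i) ν :=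
  .of_mem_Icc 0 1 (hM.measurable_winProb hx).aemeasurable <| by
    filter_upwards [hmem] with a ha using winProb_mem_Icc (hM.outcomeLaw_mem_stdSimplex ha)

lemma integrable_grossPayoff [IsFiniteMeasure ν] (hM : IsDirectMechanism μ lo hi M) (hlo : 0 ≤ lo)
    (hb : Measurable b) (hx : Measurable x) (hbmem : ∀ᵐ a ∂ν, ∀ j, b a j ∈ Icc lo hi)
    (hxmem : ∀ᵐ a ∂ν, ∀ j, x a j ∈ Icc lo hi) :
    Integrable (fun a => grossPayoff (M.alloc (b a)) (x a) i) ν := by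
  refine .of_mem_Icc 0 hi ?_ ?_
  · simp only [grossPayoff_eq_dotProduct]
    exact (hM.measurable_outcomeLaw_dotProduct hb fun w =>
      (measurable_outcomeValue i w).comp hx).aemeasurable
  · filter_upwards [hbmem, hxmem] with a ha hxa
    exact Icc_subset_Icc_right (hxa i).2 <| grossPayoff_mem_Icc (hM.outcomeLaw_mem_stdSimplex ha)
      fun j => hlo.trans (hxa j).1

end

end IsDirectMechanism

section Envelope

variable {N : ℕ} {μ : Measure ℝ} {f : ℝ → ℝ} {lo hi : ℝ} {M : Mechanism N} {i : Fin N}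

/-- The interim probability that buyer `i` gets one of the two units when his value is `v` and all
buyers report truthfully. -/
def interimWinProb (μ : Measure ℝ) (M : Mechanism N) (i : Fin N) (v : ℝ) : ℝ :=
  ∫ x, winProb (M.alloc (Function.update x i v)) (Function.update x i v) i
    ∂(Measure.pi fun _ : Fin N => μ)

lemma HasValueDensity.ae_forall_update_mem_Icc (h : HasValueDensity μ f lo hi) {q : ℝ}
    (hq : q ∈ Icc lo hi) : ∀ᵐ x ∂(Measure.pi fun _ : Fin N => μ),
      ∀ j, Function.update x i q j ∈ Icc lo hi :=
  have := h.isProbabilityMeasure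
  ae_forall_update_mem (s := fun _ => Icc lo hi) (fun _ => h.ae_mem_Icc) hq

lemma IsDirectMechanism.integrable_payoff_update (hM : IsDirectMechanism μ lo hi M)
    (h : HasValueDensity μ f lo hi) {q v : ℝ} (hq : q ∈ Icc lo hi) (hv : v ∈ Icc lo hi) :
    Integrable (fun x => payoff M (Function.update x i q) (Function.update x i v) i)
      (Measure.pi fun _ : Fin N => μ) :=
  have := h.isProbabilityMeasure
  (hM.integrable_grossPayoff h.lo_nonneg measurable_update_left measurable_update_left
    (h.ae_forall_update_mem_Icc hq) (h.ae_forall_update_mem_Icc hv)).sub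
    (hM.integrable_interim_pay i q hq)

lemma isSubgradientOn_interimPayoff (h : HasValueDensity μ f lo hi)
    (hM : IsDirectMechanism μ lo hi M) (hIC : IsBayesNashEquilibrium μ lo hi M (truthful N)) :
    IsSubgradientOn (fun v => interimPayoff μ M (truthful N) i v v) (interimWinProb μ M i)
      (Icc lo hi) := by
  intro s hs t ht
  have := h.isProbabilityMeasure
  have hmem := h.ae_forall_update_mem_Icc (N := N) (i := i) hs
  have hpay := hM.integrable_payoff_update h (i := i) hs hs
  have hwin : Integrable (fun x => winProb (M.alloc (Function.update x i s))
      (Function.update x i s) i * (t - s)) (Measure.pi fun _ : Fin N => μ) :=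
    (hM.integrable_winProb measurable_update_left hmem).mul_const _
  refine le_trans ?_ (hIC i t ht s hs)
  simp only [interimWinProb, ← integral_mul_const]
  refine (integral_add hpay hwin).symm.trans_le
    (integral_mono_ae (hpay.add hwin) (hM.integrable_payoff_update h hs ht) ?_)
  filter_upwards [hmem] with x hx
  have hgross := grossPayoff_add_winProb_mul_le (i := i) (x := Function.update x i s)
    (hM.outcomeLaw_mem_stdSimplex hx) t
  rw [Function.update_self, Function.update_idem] at hgross
  simp only [payoff]
  change _ ≤ grossPayoff (M.alloc (Function.update x i s)) (Function.update x i t) i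
    - M.pay (Function.update x i s) i
  linarith

lemma integrable_payoff (h : HasValueDensity μ f lo hi) (hM : IsDirectMechanism μ lo hi M) :
    Integrable (fun x => payoff M x x i) (Measure.pi fun _ : Fin N => μ) :=
  have := h.isProbabilityMeasure
  have hmem := ae_forall_mem (ι := Fin N) fun _ => h.ae_mem_Icc
  (hM.integrable_grossPayoff h.lo_nonneg measurable_id measurable_id hmem hmem).sub
    (hM.integrable_pay i)

lemma integrable_winProb_mul_invHazard (h : HasValueDensity μ f lo hi)
    (hM : IsDirectMechanism μ lo hi M) :
    Integrable (fun x => winProb (M.alloc x) x i * invHazard μ f (x i))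
      (Measure.pi fun _ : Fin N => μ) := by
  have := h.isProbabilityMeasure
  have hinv : Integrable (fun x : Fin N → ℝ => invHazard μ f (x i))
      (Measure.pi fun _ : Fin N => μ) :=
    (measurePreserving_eval (fun _ : Fin N => μ) i).integrable_comp_of_integrable
      h.integrable_invHazard
  refine hinv.bdd_mul (c := 1) (hM.measurable_winProb measurable_id).aestronglyMeasurable ?_
  filter_upwards [ae_forall_mem (ι := Fin N) fun _ => h.ae_mem_Icc] with x hx
  have hwin := winProb_mem_Icc (x := x) (i := i) (hM.outcomeLaw_mem_stdSimplex hx)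
  exact (Real.norm_of_nonneg hwin.1).trans_le hwin.2

theorem integral_payoff (h : HasValueDensity μ f lo hi) (hf : ∀ x ∈ Ioo lo hi, 0 < f x)
    (hM : IsDirectMechanism μ lo hi M) (hIC : IsBayesNashEquilibrium μ lo hi M (truthful N)) :
    ∫ x, payoff M x x i ∂(Measure.pi fun _ : Fin N => μ)
      = interimPayoff μ M (truthful N) i lo lo
        + ∫ x, winProb (M.alloc x) x i * invHazard μ f (x i)
          ∂(Measure.pi fun _ : Fin N => μ) := by
  have := h.isProbabilityMeasure
  have hsub := isSubgradientOn_interimPayoff h hM hIC (i := i)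
  have hD : IntegrableOn (interimWinProb μ M i) (Ioo lo hi) :=
    (hsub.monotoneOn.integrableOn_isCompact isCompact_Icc).mono_set Ioo_subset_Icc_self
  have hU : Integrable (fun v => interimPayoff μ M (truthful N) i v v) μ :=
    integrable_integral_update (integrable_payoff h hM) i
  have henvelope : ∀ᵐ v ∂μ, ∫ s in lo..v, interimWinProb μ M i s
      = interimPayoff μ M (truthful N) i v v - interimPayoff μ M (truthful N) i lo lo := by
    filter_upwards [h.ae_mem_Icc] with v hv
    exact (hsub.mono (Icc_subset_Icc_right hv.2)).integral_eq_sub hv.1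
  calc ∫ x, payoff M x x i ∂(Measure.pi fun _ : Fin N => μ)
      = ∫ v, interimPayoff μ M (truthful N) i v v ∂μ :=
        (integral_integral_update (integrable_payoff h hM) i).symm
    _ = interimPayoff μ M (truthful N) i lo lo
          + ∫ v, (∫ s in lo..v, interimWinProb μ M i s) ∂μ := by
        rw [integral_congr_ae henvelope, integral_sub hU (integrable_const _)]
        simp
    _ = interimPayoff μ M (truthful N) i lo lo
          + ∫ v, interimWinProb μ M i v * invHazard μ f v ∂μ := by
        rw [h.integral_intervalIntegral_eq_integral_mul_invHazard hf hD]
    _ = _ := by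
        rw [← integral_integral_update (integrable_winProb_mul_invHazard h hM) i]
        simp only [Function.update_self, integral_mul_const, interimWinProb]

end Envelope

section Revenue

variable {N : ℕ} {μ : Measure ℝ} {f : ℝ → ℝ} {lo hi : ℝ} {M : Mechanism N} {i : Fin N}

/-- The buyers' total payoff over both periods, net of their information rents, when `w` says who
got the first unit. -/
def virtualSurplus (μ : Measure ℝ) (f : ℝ → ℝ) (x : Fin N → ℝ) (w : Option (Fin N)) : ℝ :=
  ∑ i, (outcomeValue x i w - getsUnit x i w * invHazard μ f (x i))

lemma outcomeLaw_dotProduct_virtualSurplus (p x : Fin N → ℝ) :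
    outcomeLaw p ⬝ᵥ virtualSurplus μ f x
      = ∑ i, (grossPayoff p x i - winProb p x i * invHazard μ f (x i)) := by
  simp only [grossPayoff_eq_dotProduct, winProb, virtualSurplus, dotProduct, Finset.mul_sum,
    Finset.sum_mul, mul_sub, mul_assoc, ← Finset.sum_sub_distrib]
  exact Finset.sum_comm

lemma grossPayoff_sub_winProb_mul_invHazard (x : Fin N → ℝ) :
    grossPayoff (M.alloc x) x i - winProb (M.alloc x) x i * invHazard μ f (x i)
      = M.pay x i + (payoff M x x i - winProb (M.alloc x) x i * invHazard μ f (x i)) := by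
  rw [payoff]
  ring

lemma integrable_virtualSurplus (h : HasValueDensity μ f lo hi)
    (hM : IsDirectMechanism μ lo hi M) :
    Integrable (fun x => outcomeLaw (M.alloc x) ⬝ᵥ virtualSurplus μ f x)
      (Measure.pi fun _ : Fin N => μ) := by
  simp only [outcomeLaw_dotProduct_virtualSurplus, grossPayoff_sub_winProb_mul_invHazard]
  exact integrable_finsetSum _ fun i _ => (hM.integrable_pay i).add
    ((integrable_payoff h hM).sub (integrable_winProb_mul_invHazard h hM))

theorem expectedRevenue_eq_integral_virtualSurplus_sub (h : HasValueDensity μ f lo hi)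
    (hf : ∀ x ∈ Ioo lo hi, 0 < f x) (hM : IsDirectMechanism μ lo hi M)
    (hIC : IsBayesNashEquilibrium μ lo hi M (truthful N)) :
    expectedRevenue μ M = ∫ x, outcomeLaw (M.alloc x) ⬝ᵥ virtualSurplus μ f x
        ∂(Measure.pi fun _ : Fin N => μ)
      - ∑ i, interimPayoff μ M (truthful N) i lo lo := by
  have hrent (i : Fin N) := integrable_winProb_mul_invHazard h hM (i := i)
  have hnet (i : Fin N) : Integrable (fun x => payoff M x x i
      - winProb (M.alloc x) x i * invHazard μ f (x i)) (Measure.pi fun _ : Fin N => μ) :=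
    (integrable_payoff h hM).sub (hrent i)
  simp only [expectedRevenue, outcomeLaw_dotProduct_virtualSurplus,
    grossPayoff_sub_winProb_mul_invHazard]
  rw [integral_finsetSum _ fun i _ => hM.integrable_pay i,
    integral_finsetSum _ fun i _ => (hM.integrable_pay i).fun_add (hnet i),
    ← Finset.sum_sub_distrib]
  refine Finset.sum_congr rfl fun i _ => ?_
  rw [integral_add (hM.integrable_pay i) (hnet i), integral_sub (integrable_payoff h hM) (hrent i),
    integral_payoff h hf hM hIC]
  ring

/-- The mechanism that never sells and never charges anything. -/
def nullMechanism (N : ℕ) : Mechanism N := ⟨0, 0⟩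

lemma outcomeLaw_nullMechanism (b : Fin N → ℝ) :
    outcomeLaw ((nullMechanism N).alloc b) = Pi.single none 1 := outcomeLaw_zero

lemma pay_nullMechanism (b : Fin N → ℝ) : (nullMechanism N).pay b i = 0 := rfl

lemma isDirectMechanism_nullMechanism : IsDirectMechanism μ lo hi (nullMechanism N) where
  measurable_alloc _ := measurable_const
  measurable_pay _ := measurable_const
  alloc_nonneg _ _ _ := le_rfl
  sum_alloc_le_one _ _ := by simp [nullMechanism]
  integrable_pay _ := integrable_zero _ _ _
  integrable_interim_pay _ _ _ := integrable_zero _ _ _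

lemma payoff_nullMechanism (b x : Fin N → ℝ) :
    payoff (nullMechanism N) b x i = secondPeriodPayoff x i none := by
  rw [payoff, grossPayoff_eq_dotProduct, outcomeLaw_nullMechanism, single_one_dotProduct,
    outcomeValue_of_ne (by simp), pay_nullMechanism, sub_zero]

lemma interimPayoff_nullMechanism (v q : ℝ) :
    interimPayoff μ (nullMechanism N) (truthful N) i v q
      = ∫ x, secondPeriodPayoff (Function.update x i v) i none
        ∂(Measure.pi fun _ : Fin N => μ) := by
  simp only [interimPayoff, payoff_nullMechanism]

lemma integral_secondPeriodPayoff_lo (hN : 2 ≤ N) (h : HasValueDensity μ f lo hi) :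
    ∫ x, secondPeriodPayoff (Function.update x i lo) i none
      ∂(Measure.pi fun _ : Fin N => μ) = 0 := by
  have : Nontrivial (Fin N) := Fin.nontrivial_iff_two_le.2 hN
  obtain ⟨j, hj⟩ := exists_ne i
  refine integral_eq_zero_of_ae ?_
  filter_upwards [h.ae_forall_update_mem_Icc ⟨le_rfl, h.lo_lt_hi.le⟩] with x hx
  refine secondPeriodPayoff_eq_zero hj (by simp) ?_
  simpa using (hx j).1

-- This is the revenue formula for the null mechanism, which earns nothing and leaves no payoff to
-- the lowest types.
lemma integral_virtualSurplus_none (hN : 2 ≤ N) (h : HasValueDensity μ f lo hi)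
    (hf : ∀ x ∈ Ioo lo hi, 0 < f x) :
    ∫ x, virtualSurplus μ f x none ∂(Measure.pi fun _ : Fin N => μ) = 0 := by
  have hIC : IsBayesNashEquilibrium μ lo hi (nullMechanism N) (truthful N) := fun i v _ q _ => by
    simp only [interimPayoff_nullMechanism, le_refl]
  have hrev := expectedRevenue_eq_integral_virtualSurplus_sub h hf
    isDirectMechanism_nullMechanism hIC
  simpa [interimPayoff_nullMechanism, integral_secondPeriodPayoff_lo hN h,
    outcomeLaw_nullMechanism, expectedRevenue, pay_nullMechanism] using hrev.symm

lemma integrable_virtualSurplus_none (h : HasValueDensity μ f lo hi) :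
    Integrable (fun x => virtualSurplus μ f x none) (Measure.pi fun _ : Fin N => μ) := by
  simpa [outcomeLaw_nullMechanism]
    using integrable_virtualSurplus h (isDirectMechanism_nullMechanism (N := N))

end Revenue

/-! ### Pointwise maximization of the virtual surplus -/

section VirtualSurplus

variable {N : ℕ} {μ : Measure ℝ} {f : ℝ → ℝ} {σ : Equiv.Perm (Fin N)} {x : Fin N → ℝ}
  {i j k l m r : Fin N} {w : Option (Fin N)}

lemma outcomeValue_eq_zero (hj : j ≠ i) (hwi : w ≠ some i) (hwj : w ≠ some j) (h : x i ≤ x j) :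
    outcomeValue x i w = 0 := by
  rw [outcomeValue_of_ne hwi, secondPeriodPayoff_eq_zero hj hwj h]

lemma getsUnit_eq_zero (hj : j ≠ i) (hwi : w ≠ some i) (hwj : w ≠ some j) (h : x i ≤ x j) :
    getsUnit x i w = 0 :=
  if_neg (not_or.2 ⟨hwi, (h.trans (le_rivalMax hj hwj)).not_gt⟩)

lemma virtualSurplus_eq (hm : w ≠ some m) (hr : w ≠ some r) (hlt : x r < x m)
    (hrest : ∀ l, l ≠ m → w ≠ some l → x l ≤ x r) :
    virtualSurplus μ f x w
      = w.elim 0 (fun l => x l - invHazard μ f (x l)) + (x m - x r - invHazard μ f (x m)) := by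
  have hrm : r ≠ m := by
    rintro rfl
    exact hlt.false
  have hmax : rivalMax x m w = x r := rivalMax_eq hrm hr hrest
  have hwinner : outcomeValue x m w - getsUnit x m w * invHazard μ f (x m)
      = x m - x r - invHazard μ f (x m) := by
    rw [outcomeValue_of_ne hm, secondPeriodPayoff_eq, hmax, max_eq_left (sub_pos.2 hlt).le,
      getsUnit, if_pos (Or.inr (hmax.trans_lt hlt)), one_mul]
  have hlosers (l : Fin N) (hlm : l ≠ m) (hlw : w ≠ some l) :
      outcomeValue x l w - getsUnit x l w * invHazard μ f (x l) = 0 := by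
    have hle : x l ≤ x m := (hrest l hlm hlw).trans hlt.le
    rw [outcomeValue_eq_zero hlm.symm hlw hm hle, getsUnit_eq_zero hlm.symm hlw hm hle, zero_mul,
      sub_zero]
  rw [virtualSurplus]
  rcases w with _ | p
  · rw [Fintype.sum_eq_single m fun l hl => hlosers l hl (by simp), hwinner, Option.elim, zero_add]
  · have hpm : p ≠ m := by simpa using hm
    rw [Fintype.sum_eq_add p m hpm fun l hl => hlosers l hl.2 (by simpa using hl.1.symm), hwinner,
      outcomeValue_self, getsUnit, if_pos (Or.inl rfl), one_mul, Option.elim]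

namespace AreTopThree

lemma virtualSurplus_none (h : AreTopThree σ x i j k) (hx : Function.Injective x) :
    virtualSurplus μ f x none = x i - x j - invHazard μ f (x i) := by
  rw [virtualSurplus_eq (m := i) (r := j) (by simp) (by simp) ((rankedAbove_iff_lt hx).1 h.first),
    Option.elim, zero_add]
  intro l hli _
  by_cases hlj : l = j
  · rw [hlj]
  · exact (h.second_rankedAbove hli hlj).le

lemma virtualSurplus_first (h : AreTopThree σ x i j k) (hx : Function.Injective x) :
    virtualSurplus μ f x (some i)
      = virtualSurplus μ f x none + (x j - invHazard μ f (x j) + (x j - x k)) := by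
  rw [h.virtualSurplus_none hx, virtualSurplus_eq (m := j) (r := k) (by simpa using h.first.ne)
    (by simpa using (h.first.trans h.second).ne) ((rankedAbove_iff_lt hx).1 h.second), Option.elim]
  · ring
  · intro l hlj hli
    by_cases hlk : l = k
    · rw [hlk]
    · exact (h.rest l (by simpa [eq_comm] using hli) hlj hlk).le

lemma virtualSurplus_second (h : AreTopThree σ x i j k) (hx : Function.Injective x) :
    virtualSurplus μ f x (some j)
      = virtualSurplus μ f x none + (x j - invHazard μ f (x j) + (x j - x k)) := by
  rw [h.virtualSurplus_none hx, virtualSurplus_eq (m := i) (r := k)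
    (by simpa using h.first.ne.symm) (by simpa using h.second.ne)
    ((rankedAbove_iff_lt hx).1 (h.first.trans h.second)), Option.elim]
  · ring
  · intro l hli hlj
    by_cases hlk : l = k
    · rw [hlk]
    · exact (h.rest l hli (by simpa [eq_comm] using hlj) hlk).le

lemma virtualSurplus_of_ne (h : AreTopThree σ x i j k) (hx : Function.Injective x)
    (hli : l ≠ i) (hlj : l ≠ j) :
    virtualSurplus μ f x (some l)
      = virtualSurplus μ f x none + (x l - invHazard μ f (x l)) := by
  rw [h.virtualSurplus_none hx, virtualSurplus_eq (m := i) (r := j) (by simpa using hli)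
    (by simpa using hlj) ((rankedAbove_iff_lt hx).1 h.first), Option.elim, add_comm]
  intro m hmi _
  by_cases hmj : m = j
  · rw [hmj]
  · exact (h.second_rankedAbove hmi hmj).le

end AreTopThree

end VirtualSurplus

/-! ### Feasibility of the modified third-price auction -/

section Measurability

variable {N : ℕ} {μ : Measure ℝ} {f : ℝ → ℝ} {lo hi : ℝ} {ψ : ℝ → EReal}
  {σ : Equiv.Perm (Fin N)} {i : Fin N}

lemma measurable_kthHighest {n : ℕ} (hn : n ∈ Icc 1 N) :
    Measurable fun b : Fin N → ℝ => kthHighest b n := by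
  refine measurable_of_Ici fun c => ?_
  simp only [preimage, mem_Ici, le_kthHighest_iff hn, Finset.card_filter]
  exact measurableSet_le measurable_const (Finset.measurable_sum _ fun j _ =>
    .ite (measurableSet_le measurable_const (measurable_pi_apply j))
      measurable_const measurable_const)

lemma measurableSet_rankedAbove (i j : Fin N) : MeasurableSet {b | RankedAbove σ b i j} :=
  (measurableSet_lt (measurable_pi_apply j) (measurable_pi_apply i)).union
    ((measurableSet_eq_fun (measurable_pi_apply j) (measurable_pi_apply i)).inter (.const _))

lemma measurable_position : Measurable fun b : Fin N → ℝ => position σ b i := by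
  simp only [position, Finset.card_filter]
  exact (Finset.measurable_sum _ fun j _ =>
    .ite (measurableSet_rankedAbove j i) measurable_const measurable_const).add_const 1

lemma threshold_eq_zero {x : ℝ} (hx : hi < x) : threshold ψ lo hi x = 0 := by
  have hempty : thresholdSet ψ lo hi x = ∅ :=
    eq_empty_of_forall_notMem fun a ha => (hx.trans_le ha.2.1).not_ge ha.1.2
  exact (congrArg sInf hempty).trans Real.sInf_empty

lemma monotoneOn_threshold (h : (thresholdSet ψ lo hi hi).Nonempty) :
    MonotoneOn (threshold ψ lo hi) (Iic hi) := by
  have hanti {x y : ℝ} (hxy : x ≤ y) : thresholdSet ψ lo hi y ⊆ thresholdSet ψ lo hi x :=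
    fun a ha => ⟨ha.1, hxy.trans ha.2.1, le_trans (by exact_mod_cast hxy) ha.2.2⟩
  exact fun x _ y hy hxy =>
    csInf_le_csInf bddBelow_thresholdSet (h.mono (hanti hy)) (hanti hxy)

lemma measurable_threshold (h : (thresholdSet ψ lo hi hi).Nonempty) :
    Measurable (threshold ψ lo hi) := by
  have heq : threshold ψ lo hi
      = (Iic hi).indicator fun x => threshold ψ lo hi (min x hi) := by
    ext x
    by_cases hx : x ≤ hi
    · rw [indicator_of_mem (mem_Iic.2 hx), min_eq_left hx]
    · rw [indicator_of_notMem (by simpa using hx), threshold_eq_zero (not_le.1 hx)]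
  have hmono : Monotone fun x => threshold ψ lo hi (min x hi) := fun x y hxy =>
    monotoneOn_threshold h (min_le_right x hi) (min_le_right y hi) (min_le_min_right hi hxy)
  rw [heq]
  exact hmono.measurable.indicator measurableSet_Iic

lemma HasValueDensity.measurable_virtualValue (h : HasValueDensity μ f lo hi) :
    Measurable (virtualValue μ f) :=
  measurable_coe_real_ereal.sub
    ((measurable_const.sub (monotone_cdf μ).measurable).ennreal_ofReal.div
      h.measurable_density.ennreal_ofReal).coe_ereal_ennreal

lemma measurableSet_isAllocated (hN : 3 ≤ N) (ha : Measurable (threshold ψ lo hi)) :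
    MeasurableSet {b : Fin N → ℝ | IsAllocated ψ lo hi b} :=
  measurableSet_le (ha.comp (measurable_kthHighest ⟨by lia, hN⟩))
    (measurable_kthHighest ⟨by lia, by lia⟩)

lemma measurable_thirdPriceAlloc (hN : 3 ≤ N) (ha : Measurable (threshold ψ lo hi)) :
    Measurable fun b : Fin N → ℝ => thirdPriceAlloc ψ lo hi σ b i :=
  .ite ((measurableSet_isAllocated hN ha).inter (measurable_position (measurableSet_singleton 2)))
    measurable_const measurable_const

lemma measurable_thirdPricePay (hN : 3 ≤ N) (hψ : Measurable ψ)
    (ha : Measurable (threshold ψ lo hi)) :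
    Measurable fun b : Fin N → ℝ => thirdPricePay ψ lo hi σ b i := by
  have hthird : Measurable fun b : Fin N → ℝ => kthHighest b 3 :=
    measurable_kthHighest ⟨by lia, hN⟩
  have hthreshold := ha.comp hthird
  have hneg : MeasurableSet {b : Fin N → ℝ | ψ (kthHighest b 3) < 0} :=
    measurableSet_lt (hψ.comp hthird) measurable_const
  exact .ite (measurableSet_isAllocated hN ha)
    (.ite (measurable_position (measurableSet_singleton 1))
      (.ite hneg (hthreshold.sub hthird) measurable_const)
      (.ite (measurable_position (measurableSet_singleton 2))
        (.ite hneg hthreshold hthird) measurable_const)) measurable_const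

end Measurability

section Feasible

variable {N : ℕ} {μ : Measure ℝ} {f : ℝ → ℝ} {lo hi : ℝ} {ψ : ℝ → EReal}
  {σ : Equiv.Perm (Fin N)} {τ : Equiv.Perm (Fin N) → ℝ} {b : Fin N → ℝ} {i : Fin N}

lemma outcomeLaw_modifiedThirdPriceAuction_mem_stdSimplex (hN : 2 ≤ N)
    (hτ : τ ∈ stdSimplex ℝ (Equiv.Perm (Fin N))) :
    outcomeLaw ((modifiedThirdPriceAuction ψ lo hi τ).alloc b)
      ∈ stdSimplex ℝ (Option (Fin N)) := by
  rw [modifiedThirdPriceAuction, outcomeLaw_mixture hτ.2]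
  refine (convex_stdSimplex ℝ _).sum_mem (fun σ _ => hτ.1 σ) hτ.2 fun σ _ => ?_
  obtain ⟨j, hj⟩ := exists_position_eq σ b (n := 2) ⟨by lia, hN⟩
  rw [outcomeLaw_thirdPriceAlloc hj]
  exact single_mem_stdSimplex ℝ _

lemma kthHighest_mem {s : Set ℝ} {n : ℕ} (hn : n ∈ Icc 1 N) (hb : ∀ j, b j ∈ s) :
    kthHighest b n ∈ s := by
  obtain ⟨j, rfl⟩ := exists_position_eq 1 b hn
  exact kthHighest_position (σ := 1) ▸ hb j

lemma thirdPricePay_mem_Icc (hN : 3 ≤ N) (hψ : 0 ≤ ψ hi) (hlo : 0 ≤ lo)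
    (hb : ∀ j, b j ∈ Icc lo hi) : thirdPricePay ψ lo hi σ b i ∈ Icc 0 hi := by
  have hthird : kthHighest b 3 ∈ Icc lo hi := kthHighest_mem ⟨by lia, hN⟩ hb
  have hne := thresholdSet_nonempty hψ hthird
  obtain ⟨-, hthreshold⟩ := threshold_mem_Icc hne
  have hle := le_threshold hne
  unfold thirdPricePay
  split_ifs <;> constructor <;> linarith [hthird.1, hthird.2]

lemma pay_modifiedThirdPriceAuction_mem_Icc (hN : 3 ≤ N) (hψ : 0 ≤ ψ hi) (hlo : 0 ≤ lo)
    (hτ : τ ∈ stdSimplex ℝ (Equiv.Perm (Fin N))) (hb : ∀ j, b j ∈ Icc lo hi) :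
    (modifiedThirdPriceAuction ψ lo hi τ).pay b i ∈ Icc 0 hi :=
  dotProduct_mem_of_mem_stdSimplex (convex_Icc _ _) hτ fun _ => thirdPricePay_mem_Icc hN hψ hlo hb

theorem isDirectMechanism_modifiedThirdPriceAuction (hN : 3 ≤ N)
    (h : HasValueDensity μ f lo hi) (hτ : τ ∈ stdSimplex ℝ (Equiv.Perm (Fin N))) :
    IsDirectMechanism μ lo hi (modifiedThirdPriceAuction (virtualValue μ f) lo hi τ) := by
  have := h.isProbabilityMeasure
  have hψ := h.virtualValue_hi_nonneg
  have ha : Measurable (threshold (virtualValue μ f) lo hi) :=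
    measurable_threshold (thresholdSet_nonempty hψ ⟨h.lo_lt_hi.le, le_rfl⟩)
  have hpay (i : Fin N) :
      Measurable fun b => (modifiedThirdPriceAuction (virtualValue μ f) lo hi τ).pay b i :=
    Finset.measurable_sum _ fun σ _ =>
      (measurable_thirdPricePay hN h.measurable_virtualValue ha).const_mul _
  have hlaw (b : Fin N → ℝ) := outcomeLaw_modifiedThirdPriceAuction_mem_stdSimplex
    (ψ := virtualValue μ f) (lo := lo) (hi := hi) (b := b) (by lia) hτ
  exact {
    measurable_alloc := fun i => Finset.measurable_sum _ fun σ _ =>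
      (measurable_thirdPriceAlloc hN ha).const_mul _
    measurable_pay := hpay
    alloc_nonneg := fun b _ i => (hlaw b).1 (some i)
    sum_alloc_le_one := fun b _ => sub_nonneg.1 ((hlaw b).1 none)
    integrable_pay := fun i => by
      refine .of_mem_Icc 0 hi (hpay i).aemeasurable ?_
      filter_upwards [ae_forall_mem (ι := Fin N) fun _ => h.ae_mem_Icc] with x hx
      exact pay_modifiedThirdPriceAuction_mem_Icc hN hψ h.lo_nonneg hτ hx
    integrable_interim_pay := fun i q hq => by
      refine .of_mem_Icc 0 hi ((hpay i).comp measurable_update_left).aemeasurable ?_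
      filter_upwards [h.ae_forall_update_mem_Icc hq] with x hx
      exact pay_modifiedThirdPriceAuction_mem_Icc hN hψ h.lo_nonneg hτ hx }

lemma IsExPostEquilibrium.isBayesNashEquilibrium {M : Mechanism N}
    (hEP : IsExPostEquilibrium lo hi M (truthful N)) (h : HasValueDensity μ f lo hi)
    (hM : IsDirectMechanism μ lo hi M) : IsBayesNashEquilibrium μ lo hi M (truthful N) := by
  intro i v hv q hq
  refine integral_mono_ae (hM.integrable_payoff_update h hq hv)
    (hM.integrable_payoff_update h hv hv) ?_
  filter_upwards [h.ae_forall_update_mem_Icc hv] with x hx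
  simpa [truthful] using hEP (Function.update x i v) hx i q hq

lemma integrable_secondPeriodPayoff_update (h : HasValueDensity μ f lo hi) {v : ℝ}
    (hv : v ∈ Icc lo hi) : Integrable (fun x => secondPeriodPayoff (Function.update x i v) i none)
      (Measure.pi fun _ : Fin N => μ) := by
  simpa only [payoff_nullMechanism]
    using isDirectMechanism_nullMechanism.integrable_payoff_update h (i := i) hv hv

theorem isFeasible_modifiedThirdPriceAuction (hN : 3 ≤ N)
    (h : HasValueDensity μ f lo hi) (hτ : τ ∈ stdSimplex ℝ (Equiv.Perm (Fin N))) :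
    IsFeasible μ lo hi (modifiedThirdPriceAuction (virtualValue μ f) lo hi τ) := by
  have hψ := h.virtualValue_hi_nonneg
  have hM := isDirectMechanism_modifiedThirdPriceAuction hN h hτ
  have hEP : IsExPostEquilibrium lo hi (modifiedThirdPriceAuction (virtualValue μ f) lo hi τ)
    (truthful N) := isExPostEquilibrium_modifiedThirdPriceAuction hN hψ hτ
  refine ⟨hM, hEP.isBayesNashEquilibrium h hM, fun i v hv => ?_⟩
  refine integral_mono_ae (integrable_secondPeriodPayoff_update h hv)
    (hM.integrable_payoff_update h hv hv) ?_
  filter_upwards [h.ae_forall_update_mem_Icc hv] with x hx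
  exact secondPeriodPayoff_none_le_payoff hN hψ hτ hx

lemma interimPayoff_modifiedThirdPriceAuction_lo (hN : 3 ≤ N)
    (h : HasValueDensity μ f lo hi) (hτ : ∑ σ, τ σ = 1) :
    interimPayoff μ (modifiedThirdPriceAuction (virtualValue μ f) lo hi τ) (truthful N) i lo lo
      = 0 := by
  refine integral_eq_zero_of_ae ?_
  filter_upwards [h.ae_forall_update_mem_Icc ⟨le_rfl, h.lo_lt_hi.le⟩] with x hx
  exact payoff_modifiedThirdPriceAuction_eq_zero hN h.virtualValue_hi_nonneg hτ hx
    (by simp [truthful])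

end Feasible

/-! ### Optimality -/

section RegularProfile

variable {N : ℕ} {μ : Measure ℝ} {f : ℝ → ℝ} {lo hi : ℝ} {ψ : ℝ → EReal}
  {σ : Equiv.Perm (Fin N)} {τ : Equiv.Perm (Fin N) → ℝ} {x : Fin N → ℝ} {i j k : Fin N}
  {w : Option (Fin N)}

lemma threshold_le_iff (hψ : MonotoneOn ψ (Icc lo hi)) (h0 : 0 ≤ ψ hi) {u v : ℝ}
    (hu : u ∈ Icc lo hi) (hv : v ∈ Icc lo hi) (huv : u ≤ v) (hne : v ≠ threshold ψ lo hi u) :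
    threshold ψ lo hi u ≤ v ↔ (u : EReal) ≤ v + ψ v := by
  refine ⟨fun h => ?_, fun h => threshold_le_of_mem ⟨hv, huv, h⟩⟩
  obtain ⟨a, ha, hav⟩ := exists_lt_of_csInf_lt (thresholdSet_nonempty h0 hu) (h.lt_of_ne' hne)
  calc (u : EReal) ≤ a + ψ a := ha.2.2
    _ ≤ v + ψ v := add_le_add (by exact_mod_cast hav.le) (hψ ha.1 hv hav.le)

lemma AreTopThree.optimalRevenueAt_eq (h : AreTopThree σ x i j k) (hf : 0 < f (x j)) :
    optimalRevenueAt (virtualValue μ f) x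
      = max (x j - invHazard μ f (x j) + (x j - x k)) 0 := by
  rw [optimalRevenueAt, h.kthHighest_two, h.kthHighest_three, virtualValue_eq hf, ← EReal.coe_add,
    ← EReal.coe_zero, ← EReal.coe_strictMono.monotone.map_max, EReal.toReal_coe]

open Classical in
lemma AreTopThree.outcomeLaw_modifiedThirdPriceAuction (h : AreTopThree σ x i j k)
    (hx : Function.Injective x) (hτ : ∑ s, τ s = 1) :
    outcomeLaw ((modifiedThirdPriceAuction ψ lo hi τ).alloc x)
      = Pi.single (if IsAllocated ψ lo hi x then some j else none) 1 := by
  have hj (s : Equiv.Perm (Fin N)) : position s x j = 2 := by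
    simpa only [position, rankedAbove_iff_lt hx] using h.position_second
  simp only [modifiedThirdPriceAuction, outcomeLaw_mixture hτ, outcomeLaw_thirdPriceAlloc (hj _),
    ← Finset.sum_smul, hτ, one_smul]

/-- A profile of values in the interior of the support without ties and without a value on the
threshold of another one. Almost every profile is regular. -/
structure IsRegularProfile (ψ : ℝ → EReal) (lo hi : ℝ) (x : Fin N → ℝ) : Prop where
  mem_Ioo : ∀ j, x j ∈ Ioo lo hi
  injective : Function.Injective x
  ne_threshold : ∀ i j, i ≠ j → x i ≠ threshold ψ lo hi (x j)

lemma HasValueDensity.ae_isRegularProfile (h : HasValueDensity μ f lo hi) :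
    ∀ᵐ x ∂(Measure.pi fun _ : Fin N => μ), IsRegularProfile (virtualValue μ f) lo hi x := by
  have := h.isProbabilityMeasure
  have := h.nullSingletonClass
  have hne {g : ℝ → ℝ} (hg : Measurable g) :
      ∀ᵐ x ∂(Measure.pi fun _ : Fin N => μ), ∀ i j, i ≠ j → x i ≠ g (x j) := by
    simp only [ae_all_iff]
    exact fun i j hij => ae_ne_of_measurable hij hg
  have hthreshold : Measurable (threshold (virtualValue μ f) lo hi) :=
    measurable_threshold (thresholdSet_nonempty h.virtualValue_hi_nonneg ⟨h.lo_lt_hi.le, le_rfl⟩)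
  filter_upwards [ae_forall_mem fun _ => h.ae_mem_Ioo, hne measurable_id, hne hthreshold]
    with x hmem hinj hthr
  exact ⟨hmem, fun i j hij => not_imp_not.1 (hinj i j) hij, hthr⟩

namespace IsRegularProfile

lemma isAllocated_iff (hx : IsRegularProfile (virtualValue μ f) lo hi x)
    (h : HasValueDensity μ f lo hi) (hψ : MonotoneOn (virtualValue μ f) (Icc lo hi))
    (htop : AreTopThree σ x i j k) :
    IsAllocated (virtualValue μ f) lo hi x
      ↔ 0 ≤ x j - invHazard μ f (x j) + (x j - x k) := by
  have hmem (l : Fin N) : x l ∈ Icc lo hi := Ioo_subset_Icc_self (hx.mem_Ioo l)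
  rw [htop.isAllocated_iff, threshold_le_iff hψ h.virtualValue_hi_nonneg (hmem k) (hmem j)
    htop.second.le (hx.ne_threshold j k htop.second.ne),
    virtualValue_eq (h.density_pos hψ (hx.mem_Ioo j)), ← EReal.coe_add, EReal.coe_le_coe_iff]
  constructor <;> intro <;> linarith

lemma virtualSurplus_le (hN : 3 ≤ N) (hx : IsRegularProfile (virtualValue μ f) lo hi x)
    (h : HasValueDensity μ f lo hi) (hψ : MonotoneOn (virtualValue μ f) (Icc lo hi)) :
    virtualSurplus μ f x w
      ≤ virtualSurplus μ f x none + optimalRevenueAt (virtualValue μ f) x := by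
  obtain ⟨i, j, k, htop⟩ := exists_areTopThree hN 1 x
  have hpos (l : Fin N) : 0 < f (x l) := h.density_pos hψ (hx.mem_Ioo l)
  rw [htop.optimalRevenueAt_eq (hpos j)]
  rcases w with _ | l
  · exact le_add_of_nonneg_right (le_max_right _ _)
  by_cases hli : l = i
  · rw [hli, htop.virtualSurplus_first hx.injective]
    gcongr
    exact le_max_left _ _
  by_cases hlj : l = j
  · rw [hlj, htop.virtualSurplus_second hx.injective]
    gcongr
    exact le_max_left _ _
  have hmono : x l - invHazard μ f (x l) ≤ x j - invHazard μ f (x j) := by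
    have := hψ (Ioo_subset_Icc_self (hx.mem_Ioo l)) (Ioo_subset_Icc_self (hx.mem_Ioo j))
      (htop.second_rankedAbove hli hlj).le
    rwa [virtualValue_eq (hpos l), virtualValue_eq (hpos j), EReal.coe_le_coe_iff] at this
  rw [htop.virtualSurplus_of_ne hx.injective hli hlj]
  gcongr
  exact le_max_of_le_left (hmono.trans (le_add_of_nonneg_right (sub_nonneg.2 htop.second.le)))

lemma virtualSurplus_modifiedThirdPriceAuction (hN : 3 ≤ N)
    (hx : IsRegularProfile (virtualValue μ f) lo hi x)
    (h : HasValueDensity μ f lo hi) (hψ : MonotoneOn (virtualValue μ f) (Icc lo hi))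
    (hτ : ∑ s, τ s = 1) :
    outcomeLaw ((modifiedThirdPriceAuction (virtualValue μ f) lo hi τ).alloc x)
        ⬝ᵥ virtualSurplus μ f x
      = virtualSurplus μ f x none + optimalRevenueAt (virtualValue μ f) x := by
  obtain ⟨i, j, k, htop⟩ := exists_areTopThree hN 1 x
  rw [htop.outcomeLaw_modifiedThirdPriceAuction hx.injective hτ, single_one_dotProduct,
    htop.optimalRevenueAt_eq (h.density_pos hψ (hx.mem_Ioo j))]
  have hiff := hx.isAllocated_iff h hψ htop
  split_ifs with hA
  · rw [htop.virtualSurplus_second hx.injective, max_eq_left (hiff.1 hA)]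
  · rw [max_eq_right (not_le.1 (mt hiff.2 hA)).le, add_zero]

end IsRegularProfile

end RegularProfile

section Optimality

variable {N : ℕ} {μ : Measure ℝ} {f : ℝ → ℝ} {lo hi : ℝ} {τ : Equiv.Perm (Fin N) → ℝ}
  {M : Mechanism N}

lemma ae_virtualSurplus_modifiedThirdPriceAuction (hN : 3 ≤ N) (h : HasValueDensity μ f lo hi)
    (hψ : MonotoneOn (virtualValue μ f) (Icc lo hi)) (hτ : ∑ s, τ s = 1) :
    ∀ᵐ x ∂(Measure.pi fun _ : Fin N => μ),
      outcomeLaw ((modifiedThirdPriceAuction (virtualValue μ f) lo hi τ).alloc x)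
          ⬝ᵥ virtualSurplus μ f x
        = virtualSurplus μ f x none + optimalRevenueAt (virtualValue μ f) x := by
  filter_upwards [h.ae_isRegularProfile] with x hx
  exact hx.virtualSurplus_modifiedThirdPriceAuction hN h hψ hτ

lemma integrable_optimalRevenueAt (hN : 3 ≤ N) (h : HasValueDensity μ f lo hi)
    (hψ : MonotoneOn (virtualValue μ f) (Icc lo hi)) :
    Integrable (fun x : Fin N → ℝ => optimalRevenueAt (virtualValue μ f) x)
      (Measure.pi fun _ : Fin N => μ) := by
  have hτ := single_mem_stdSimplex ℝ (1 : Equiv.Perm (Fin N))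
  refine ((integrable_virtualSurplus h
    (isDirectMechanism_modifiedThirdPriceAuction hN h hτ)).sub
      (integrable_virtualSurplus_none h)).congr ?_
  filter_upwards [ae_virtualSurplus_modifiedThirdPriceAuction hN h hψ hτ.2] with x hx
  exact sub_eq_of_eq_add' hx

lemma integral_virtualSurplus_none_add (hN : 3 ≤ N) (h : HasValueDensity μ f lo hi)
    (hψ : MonotoneOn (virtualValue μ f) (Icc lo hi)) :
    ∫ x : Fin N → ℝ, virtualSurplus μ f x none + optimalRevenueAt (virtualValue μ f) x
        ∂(Measure.pi fun _ : Fin N => μ)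
      = ∫ x, optimalRevenueAt (virtualValue μ f) x ∂(Measure.pi fun _ : Fin N => μ) := by
  rw [integral_add (integrable_virtualSurplus_none h) (integrable_optimalRevenueAt hN h hψ),
    integral_virtualSurplus_none (by lia) h fun x hx => h.density_pos hψ hx, zero_add]

theorem expectedRevenue_modifiedThirdPriceAuction (hN : 3 ≤ N) (h : HasValueDensity μ f lo hi)
    (hψ : MonotoneOn (virtualValue μ f) (Icc lo hi))
    (hτ : τ ∈ stdSimplex ℝ (Equiv.Perm (Fin N))) :
    expectedRevenue μ (modifiedThirdPriceAuction (virtualValue μ f) lo hi τ)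
      = ∫ x, optimalRevenueAt (virtualValue μ f) x ∂(Measure.pi fun _ : Fin N => μ) := by
  have hfeasible := isFeasible_modifiedThirdPriceAuction hN h hτ
  rw [expectedRevenue_eq_integral_virtualSurplus_sub h (fun x hx => h.density_pos hψ hx)
    hfeasible.isDirectMechanism hfeasible.incentiveCompatible,
    integral_congr_ae (ae_virtualSurplus_modifiedThirdPriceAuction hN h hψ hτ.2),
    integral_virtualSurplus_none_add hN h hψ,
    Finset.sum_eq_zero fun i _ => interimPayoff_modifiedThirdPriceAuction_lo hN h hτ.2, sub_zero]

lemma IsIndividuallyRational.interimPayoff_lo_nonneg (hIR : IsIndividuallyRational μ lo hi M)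
    (hN : 2 ≤ N) (h : HasValueDensity μ f lo hi) (i : Fin N) :
    0 ≤ interimPayoff μ M (truthful N) i lo lo :=
  (integral_secondPeriodPayoff_lo hN h).symm.trans_le (hIR i lo ⟨le_rfl, h.lo_lt_hi.le⟩)

theorem IsFeasible.expectedRevenue_le (hM : IsFeasible μ lo hi M) (hN : 3 ≤ N)
    (h : HasValueDensity μ f lo hi) (hψ : MonotoneOn (virtualValue μ f) (Icc lo hi)) :
    expectedRevenue μ M
      ≤ ∫ x, optimalRevenueAt (virtualValue μ f) x ∂(Measure.pi fun _ : Fin N => μ) := by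
  have := h.isProbabilityMeasure
  have hDM := hM.isDirectMechanism
  have hrent : 0 ≤ ∑ i, interimPayoff μ M (truthful N) i lo lo := Finset.sum_nonneg fun i _ =>
    hM.individuallyRational.interimPayoff_lo_nonneg (by lia) h i
  have hsurplus : ∀ᵐ x ∂(Measure.pi fun _ : Fin N => μ),
      outcomeLaw (M.alloc x) ⬝ᵥ virtualSurplus μ f x
        ≤ virtualSurplus μ f x none + optimalRevenueAt (virtualValue μ f) x := by
    filter_upwards [h.ae_isRegularProfile, ae_forall_mem fun _ => h.ae_mem_Icc] with x hx hmem
    exact dotProduct_mem_of_mem_stdSimplex (convex_Iic _) (hDM.outcomeLaw_mem_stdSimplex hmem)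
      fun _ => hx.virtualSurplus_le hN h hψ
  calc expectedRevenue μ M
      = ∫ x, outcomeLaw (M.alloc x) ⬝ᵥ virtualSurplus μ f x ∂(Measure.pi fun _ : Fin N => μ)
          - ∑ i, interimPayoff μ M (truthful N) i lo lo :=
        expectedRevenue_eq_integral_virtualSurplus_sub h (fun x hx => h.density_pos hψ hx) hDM
          hM.incentiveCompatible
    _ ≤ ∫ x, outcomeLaw (M.alloc x) ⬝ᵥ virtualSurplus μ f x ∂(Measure.pi fun _ : Fin N => μ) :=
        sub_le_self _ hrent
    _ ≤ ∫ x, virtualSurplus μ f x none + optimalRevenueAt (virtualValue μ f) x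
          ∂(Measure.pi fun _ : Fin N => μ) :=
        integral_mono_ae (integrable_virtualSurplus h hDM)
          ((integrable_virtualSurplus_none h).add (integrable_optimalRevenueAt hN h hψ)) hsurplus
    _ = ∫ x, optimalRevenueAt (virtualValue μ f) x ∂(Measure.pi fun _ : Fin N => μ) :=
        integral_virtualSurplus_none_add hN h hψ

end Optimality

end SequentialAuction

end

open SequentialAuction in
theorem theorem5_general {N : ℕ} (hN : 3 ≤ N) {μ : Measure ℝ} {f : ℝ → ℝ} {lo hi : ℝ}
    (hμ : HasValueDensity μ f lo hi) (hψ : MonotoneOn (virtualValue μ f) (Icc lo hi))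
    {τ : Equiv.Perm (Fin N) → ℝ} (hτ : τ ∈ stdSimplex ℝ (Equiv.Perm (Fin N)))
    {M : Mechanism N} (hM : M = modifiedThirdPriceAuction (virtualValue μ f) lo hi τ) :
    IsExPostEquilibrium lo hi M (truthful N) ∧
    IsBayesNashEquilibrium μ lo hi M (truthful N) ∧
    Integrable (fun x : Fin N → ℝ => optimalRevenueAt (virtualValue μ f) x)
      (Measure.pi fun _ : Fin N => μ) ∧
    expectedRevenue μ M =
      ∫ x, optimalRevenueAt (virtualValue μ f) x ∂(Measure.pi fun _ : Fin N => μ) ∧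
    IsFeasible μ lo hi M ∧
    ∀ M' : Mechanism N, IsFeasible μ lo hi M' → expectedRevenue μ M' ≤ expectedRevenue μ M := by
  subst hM
  have hfeasible := isFeasible_modifiedThirdPriceAuction hN hμ hτ
  have hrevenue := expectedRevenue_modifiedThirdPriceAuction hN hμ hψ hτ
  exact ⟨isExPostEquilibrium_modifiedThirdPriceAuction hN hμ.virtualValue_hi_nonneg hτ,
    hfeasible.incentiveCompatible, integrable_optimalRevenueAt hN hμ hψ, hrevenue, hfeasible,
    fun M' hM' => (hM'.expectedRevenue_le hN hμ hψ).trans_eq hrevenue.symm⟩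

open SequentialAuction in
theorem theorem5 (N : ℕ) (hN : 3 ≤ N) (μ : Measure ℝ) (f : ℝ → ℝ) (lo hi : ℝ)
    (hμ : IsValueDistribution μ f lo hi)
    (hψ : MonotoneOn (virtualValue μ f) (Icc lo hi))
    (τ : Equiv.Perm (Fin N) → ℝ) (hτ : τ ∈ stdSimplex ℝ (Equiv.Perm (Fin N)))
    (M : Mechanism N) (hM : M = modifiedThirdPriceAuction (virtualValue μ f) lo hi τ) :
    IsExPostEquilibrium lo hi M (truthful N) ∧
    IsBayesNashEquilibrium μ lo hi M (truthful N) ∧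
    Integrable (fun x : Fin N → ℝ => optimalRevenueAt (virtualValue μ f) x)
      (Measure.pi fun _ : Fin N => μ) ∧
    expectedRevenue μ M =
      ∫ x, optimalRevenueAt (virtualValue μ f) x ∂(Measure.pi fun _ : Fin N => μ) ∧
    IsFeasible μ lo hi M ∧
    ∀ M' : Mechanism N, IsFeasible μ lo hi M' → expectedRevenue μ M' ≤ expectedRevenue μ M :=
  theorem5_general hN hμ.hasValueDensity hψ hτ hM
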